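/- Let $m,n$ be non-negative integers, let $W:\mathbb R^{m\times n}\to\mathbb R$ be of class $C^1$, and put $P(F)=W_F(F)$ and $P^*(F)=W(F)I_n-F^TP(F)$. A function $V:\mathbb R^{m\times n}\to\mathbb R$ is rank-one convex if it is convex along every line $t\mapsto F+t\,a\otimes b$; it is quasiconvex if it is Borel measurable, locally bounded and satisfies $|D|\,V(F)\le\int_D V(F+\nabla\varphi)\,dx$ for every $F$, every bounded open $D\subset\mathbb R^n$ and every $\varphi\in W^{1,\infty}_0(D;\mathbb R^m)$ (that is, every Lipschitz $\varphi:\mathbb R^n\to\mathbb R^m$ vanishing outside $D$). Let $RW$ and $QW$ be the largest rank-one convex and the largest quasiconvex function not exceeding $W$, i.e. the pointwise suprema of all real-valued functions $V\le W$ of the respective kind ($-\infty$ if there are none). **Theorem.** Let $\Omega\subset\mathbb R^n$ be a bounded open set with Lipschitz boundary that is star-shaped with respect to some point of $\Omega$. Let $F_0\in\mathbb R^{m\times n}$ and let $\bar y:\overline\Omega\to\mathbb R^m$ be Lipschitz. Assume that * (BVP) $\nabla\cdot P(\nabla\bar y)=0$ and $\nabla\cdot P^*(\nabla\bar y)=0$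 in $\Omega$ in the sense of distributions, and $\bar y(x)=F_0x$ for all $x\in\partial\Omega$; * (REG) $\bar y$ is of class $C^2$, up to the boundary, on $\overline\Omega\cap U$ for some open $U\supset\partial\Omega$; * (RCX) $W(\nabla\bar y(x))=RW(\nabla\bar y(x))$ for a.e. $x\in\partial\Omega$ with respect to surface measure; * (Q=R) $RW(F_0)=QW(F_0)$. Then 1. $RW(F_0)=QW(F_0)=\frac1{|\Omega|}\int_\Omega W(\nabla\bar y)\,dx$, and $\bar y$ is a global minimizer: $\int_\Omega W(\nabla\bar y)\,dx\le\int_\Omega W(\nabla z)\,dx$ for every Lipschitz $z:\overline\Omega\to\mathbb R^m$ with $z(x)=F_0x$ on $\partial\Omega$; 2. $QW(\nabla\bar y(x))=W(\nabla\bar y(x))$ for a.e. $x\in\Omega$. -/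

import Mathlib

open MeasureTheory Set Topology
open scoped Matrix NNReal ContDiff

noncomputable section

namespace GCT

/-- Euclidean space `ℝⁿ`. -/
abbrev E (n : ℕ) := EuclideanSpace ℝ (Fin n)

/-- Real `m × n` matrices. -/
abbrev Mat (m n : ℕ) := Matrix (Fin m) (Fin n) ℝ

attribute [local instance] Matrix.normedAddCommGroup Matrix.normedSpace

variable {m n : ℕ}

/-- The inner product `⟨A, B⟩ = ∑ A_{iα} B_{iα}` of matrices. -/
def frob (A B : Mat m n) : ℝ := ∑ i, ∑ α, A i α * B i α

/-- The gradient matrix `(∇y)_{iα} = ∂yⁱ/∂x^α` of `y` at `x`. -/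
def grad (y : E n → E m) (x : E n) : Mat m n :=
  Matrix.of fun i α => (fderiv ℝ y x (EuclideanSpace.single α 1)) i

/-- The gradient matrix of `y` relative to the set `s`, used for boundary values of `∇y`. -/
def gradWithin (s : Set (E n)) (y : E n → E m) (x : E n) : Mat m n :=
  Matrix.of fun i α => (fderivWithin ℝ y s x (EuclideanSpace.single α 1)) i

/-- The linear map `x ↦ F x`. -/
def affineMap (F : Mat m n) (x : E n) : E m := WithLp.toLp 2 (F *ᵥ x.ofLp)

/-- `C¹` energy densities. -/
def IsC1Density (W : Mat m n → ℝ) : Prop := ContDiff ℝ 1 W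

/-- The Piola stress tensor `P = W_F`. -/
def piola (W : Mat m n → ℝ) (F : Mat m n) : Mat m n :=
  Matrix.of fun i α => fderiv ℝ W F (Matrix.single i α 1)

/-- The Eshelby tensor `P* = W I - Fᵀ P`. -/
def eshelby (W : Mat m n → ℝ) (F : Mat m n) : Mat n n :=
  W F • (1 : Mat n n) - Fᵀ * piola W F

/-- `∇ · A = 0` in `Ω` in the sense of distributions (divergence taken row by row). -/
def DivFree {k : ℕ} (Ω : Set (E n)) (A : E n → Mat k n) : Prop :=
  ∀ φ : E n → E k, ContDiff ℝ ∞ φ → HasCompactSupport φ → tsupport φ ⊆ Ω →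
    ∫ x in Ω, frob (A x) (grad φ x) = 0

/-- `y` is Lipschitz up to the boundary of `Ω`. -/
def IsLipschitzConfig (Ω : Set (E n)) (y : E n → E m) : Prop :=
  ∃ K : ℝ≥0, LipschitzOnWith K y (closure Ω)

/-- Stationary configurations: Lipschitz solutions of `∇ · P(∇y) = 0`, `∇ · P*(∇y) = 0`. -/
structure IsStationary (W : Mat m n → ℝ) (Ω : Set (E n)) (y : E n → E m) : Prop where
  lipschitz : IsLipschitzConfig Ω y
  eulerLagrange : DivFree Ω fun x => piola W (grad y x)
  noether : DivFree Ω fun x => eshelby W (grad y x)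

/-- Lipschitz maps on `Ω` with affine boundary values `F x`. -/
def admissible (Ω : Set (E n)) (F : Mat m n) : Set (E n → E m) :=
  {z | IsLipschitzConfig Ω z ∧ ∀ x ∈ frontier Ω, z x = affineMap F x}

/-- The energy `∫_Ω W(∇z) dx`. For `W` continuous and `z` Lipschitz the integrand is bounded. -/
def energy (W : Mat m n → ℝ) (Ω : Set (E n)) (z : E n → E m) : ℝ :=
  ∫ x in Ω, W (grad z x)

/-- Near each boundary point, `Ω` is the region below the graph of a Lipschitz function over the
hyperplane orthogonal to some unit vector `ν`. -/
def HasLipschitzBoundary (Ω : Set (E n)) : Prop :=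
  ∀ p ∈ frontier Ω, ∃ ν : E n, ‖ν‖ = 1 ∧ ∃ (K : ℝ≥0) (γ : E n → ℝ), LipschitzWith K γ ∧
    ∃ U ∈ 𝓝 p, ∀ x ∈ U,
      (x ∈ Ω ↔ inner ℝ ν x < γ (x - (inner ℝ ν x : ℝ) • ν))

/-- `y` is of class `C²` near `∂Ω`: its derivatives up to order two are continuous up to the
boundary on the part of the closure of `Ω` in some neighbourhood of `∂Ω`. -/
def IsC2NearBoundary (Ω : Set (E n)) (y : E n → E m) : Prop :=
  ∃ U : Set (E n), IsOpen U ∧ frontier Ω ⊆ U ∧ ContDiffOn ℝ 2 y (closure Ω ∩ U)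

/-- The surface measure on `∂Ω`. It is the `(n-1)`-dimensional Hausdorff measure, up to a
constant factor. -/
def surfaceMeasure (Ω : Set (E n)) : Measure (E n) :=
  (Measure.hausdorffMeasure ((n : ℝ) - 1)).restrict (frontier Ω)

/-- Rank-one convexity: convexity along all lines in rank-one directions. -/
def IsRankOneConvex (V : Mat m n → ℝ) : Prop :=
  ∀ (F : Mat m n) (a : Fin m → ℝ) (b : Fin n → ℝ),
    ConvexOn ℝ univ fun t : ℝ => V (F + t • Matrix.vecMulVec a b)

/-- Quasiconvexity in the sense of Morrey: `V` is Borel measurable, locally bounded and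
`|D| V(F) ≤ ∫_D V(F + ∇φ)` for every bounded open `D` and every `φ ∈ W₀^{1,∞}(D)`, that is,
every Lipschitz `φ` on the whole space that vanishes outside `D`. -/
structure IsQuasiconvex (V : Mat m n → ℝ) : Prop where
  measurable : Measurable[borel (Mat m n)] V
  locallyBounded : ∀ F, ∃ C : ℝ, ∀ᶠ G in 𝓝 F, |V G| ≤ C
  jensen : ∀ D : Set (E n), IsOpen D → Bornology.IsBounded D →
    ∀ φ : E n → E m, (∃ K : ℝ≥0, LipschitzWith K φ) → (∀ x ∉ D, φ x = 0) →
      ∀ F : Mat m n, volume.real D * V F ≤ ∫ x in D, V (F + grad φ x)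

/-- The rank-one convex envelope: the largest rank-one convex function not exceeding `W`
(`-∞` if there is none). -/
def RW (W : Mat m n → ℝ) (F : Mat m n) : EReal :=
  ⨆ V ∈ {V : Mat m n → ℝ | IsRankOneConvex V ∧ ∀ G, V G ≤ W G}, (V F : EReal)

/-- The quasiconvex envelope: the largest quasiconvex function not exceeding `W`
(`-∞` if there is none). -/
def QW (W : Mat m n → ℝ) (F : Mat m n) : EReal :=
  ⨆ V ∈ {V : Mat m n → ℝ | IsQuasiconvex V ∧ ∀ G, V G ≤ W G}, (V F : EReal)

end GCT

end

/-! Let `x₀` be the centre of the star and `r` a real number. The Euler–Lagrange and Noether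
equations combine into a Clapeyron identity: the flux `G = (W - r)(x - x₀) - Pᵀ(∇y (x - x₀) - (y -
F₀ x₀))` has weak divergence `n (W(∇y) - r)`. The energy is thus controlled by the flux through the
boundary.

On `∂Ω` the condition `y = F₀ x` fixes the tangential derivatives, so `F = ∇y` differs from `F₀` by
a rank-one matrix `a ⊗ N`, with `N` the outward normal, and `G · N = ((x - x₀) · N) (W(F) - r -
⟨P(F), F - F₀⟩)`. The first factor is non-negative because `Ω` is star-shaped. Since `W` touches
`RW` at `F`, convexity along the line from `F₀` through `F` puts the tangent of `W` at `F` below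
`RW(F₀)` at `F₀`; the second factor is then non-positive once `r ≥ RW(F₀)`. Hence `∫ (W(∇y) - r) ≤
0` (`integral_le_of_RW_le`).

Quasiconvexity gives the opposite bound `|Ω| QW(F₀) ≤ ∫ W(∇z)` for all competitors
(`mul_le_energy`). As `RW(F₀) = QW(F₀)` the bounds meet, which gives the value and minimality;
equality forces `W = QW` at almost every gradient (`ae_QW_eq`).

The analytic difficulty is low regularity. Inside, `y` is only Lipschitz, so the equations must be
extended to Lipschitz test maps (`integral_fderiv_eq_zero_of_smooth`). The boundary is only
Lipschitz, so Gauss–Green is replaced by a one-sided inequality obtained from boundary layers in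
graph charts (`HasWeakDiv.integral_nonpos`). -/

namespace GCT

open Filter ContinuousLinearMap
open scoped Convolution

/-! ### Mollification: from smooth to Lipschitz test maps -/

section Mollify

variable {E F : Type*} [NormedAddCommGroup E] [InnerProductSpace ℝ E] [FiniteDimensional ℝ E]
  [MeasurableSpace E] [BorelSpace E] [NormedAddCommGroup F] [NormedSpace ℝ F]
  [FiniteDimensional ℝ F]

theorem stronglyMeasurable_fderiv (φ : E → F) : StronglyMeasurable (fderiv ℝ φ) := by
  borelize (E →L[ℝ] F)
  exact (measurable_fderiv ℝ φ).stronglyMeasurable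

theorem isCompact_closedBall_clm {E F : Type*} [NormedAddCommGroup E] [NormedSpace ℝ E]
    [FiniteDimensional ℝ E] [NormedAddCommGroup F] [NormedSpace ℝ F] [FiniteDimensional ℝ F]
    (T : E →L[ℝ] F) (r : ℝ) : IsCompact (Metric.closedBall T r) :=
  haveI := FiniteDimensional.proper_real (E →L[ℝ] F)
  isCompact_closedBall T r

theorem measurable_comp_fderiv {X : Type*} [TopologicalSpace X]
    [TopologicalSpace.PseudoMetrizableSpace X] [MeasurableSpace X] [BorelSpace X]
    {Q : E × (E →L[ℝ] F) → X} (hQ : Continuous Q) (φ : E → F) :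
    Measurable fun x => Q (x, fderiv ℝ φ x) :=
  (hQ.comp_stronglyMeasurable
    (stronglyMeasurable_id.prodMk (stronglyMeasurable_fderiv φ))).measurable

/-- The derivative of a mollified Lipschitz map is the mollified derivative. -/
theorem hasFDerivAt_mollify (ρ : ContDiffBump (0 : E)) {φ : E → F} {K : ℝ≥0}
    (hφ : LipschitzWith K φ) (x : E) :
    HasFDerivAt (ρ.normed volume ⋆[lsmul ℝ ℝ, volume] φ)
      ((ρ.normed volume ⋆[lsmul ℝ ℝ, volume] fderiv ℝ φ) x) x := by
  have hρc : Continuous (ρ.normed volume) := ρ.continuous_normed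
  have hρi : Integrable (ρ.normed volume) volume := ρ.integrable_normed
  have hfm : StronglyMeasurable (fderiv ℝ φ) := stronglyMeasurable_fderiv φ
  refine (hasFDerivAt_integral_of_dominated_loc_of_lip (s := univ) (μ := volume)
    (F := fun x t => ρ.normed volume t • φ (x - t))
    (F' := fun t => ρ.normed volume t • fderiv ℝ φ (x - t))
    (bound := fun t => ρ.normed volume t * K) univ_mem ?_ ?_ ?_ ?_ ?_ ?_).2
  · refine Eventually.of_forall fun z => ?_
    exact (hρc.smul (hφ.continuous.comp (continuous_const.sub continuous_id))).aestronglyMeasurable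
  · refine Continuous.integrable_of_hasCompactSupport
      (hρc.smul (hφ.continuous.comp (continuous_const.sub continuous_id))) ?_
    exact ρ.hasCompactSupport_normed.smul_right
  · exact hρc.aestronglyMeasurable.smul
      (hfm.comp_measurable (measurable_const.sub measurable_id)).aestronglyMeasurable
  · refine Eventually.of_forall fun t => ?_
    refine LipschitzWith.lipschitzOnWith (LipschitzWith.of_dist_le_mul fun a b => ?_)
    rw [dist_smul₀, Real.norm_of_nonneg (ρ.nonneg_normed t), Real.coe_nnabs,
      abs_of_nonneg (mul_nonneg (ρ.nonneg_normed t) K.coe_nonneg), mul_assoc]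
    refine mul_le_mul_of_nonneg_left ?_ (ρ.nonneg_normed t)
    simpa using hφ.dist_le_mul (a - t) (b - t)
  · exact hρi.mul_const _
  -- Rademacher gives differentiability at `x - t` for almost every `t`, so the formula holds at
  -- every `x`.
  · have h := (hφ.ae_differentiableAt (μ := volume))
    have h2 : ∀ᵐ t ∂(volume : Measure E), DifferentiableAt ℝ φ (x - t) :=
      (Measure.measurePreserving_sub_left volume x).quasiMeasurePreserving.ae h
    filter_upwards [h2] with t ht
    have : HasFDerivAt (fun z : E => z - t) (ContinuousLinearMap.id ℝ E) x :=
      (hasFDerivAt_id x).sub_const t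
    exact (ht.hasFDerivAt.comp x this).const_smul _

/-- An integral identity for smooth test maps extends to Lipschitz test maps. -/
theorem integral_fderiv_eq_zero_of_smooth {Ω : Set E} (hΩ : IsOpen Ω)
    (hΩf : volume Ω ≠ ⊤) {L : E → (E →L[ℝ] F) → ℝ}
    (hLm : ∀ Φ : E → (E →L[ℝ] F), StronglyMeasurable Φ →
      AEStronglyMeasurable (fun x => L x (Φ x)) (volume.restrict Ω))
    (hLc : ∀ x ∈ Ω, Continuous (L x))
    (hLC : ∀ R : ℝ, ∃ C, ∀ x ∈ Ω, ∀ T, ‖T‖ ≤ R → ‖L x T‖ ≤ C)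
    (h : ∀ φ : E → F, ContDiff ℝ ∞ φ → HasCompactSupport φ → tsupport φ ⊆ Ω →
      ∫ x in Ω, L x (fderiv ℝ φ x) = 0)
    {φ : E → F} {K : ℝ≥0} (hφ : LipschitzWith K φ) (hc : HasCompactSupport φ)
    (hs : tsupport φ ⊆ Ω) :
    IntegrableOn (fun x => L x (fderiv ℝ φ x)) Ω ∧ ∫ x in Ω, L x (fderiv ℝ φ x) = 0 := by
  have hfm : StronglyMeasurable (fderiv ℝ φ) := stronglyMeasurable_fderiv φ
  obtain ⟨C, hC⟩ := hLC K
  obtain ⟨δ, hδ, hδΩ⟩ : ∃ δ > 0, Metric.cthickening δ (tsupport φ) ⊆ Ω :=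
    hc.exists_cthickening_subset_open hΩ hs
  -- The outer radius `2δ/(k+2)` is at most `δ`, which keeps the supports inside `Ω`. It is twice
  -- the inner radius, and this bounded ratio is what Lebesgue differentiation of the mollified
  -- gradients requires.
  let ρ : ℕ → ContDiffBump (0 : E) := fun k =>
    ⟨δ / (k + 2), 2 * (δ / (k + 2)), by positivity, by
      have : 0 < δ / ((k : ℝ) + 2) := by positivity
      linarith⟩
  have hρ0 : Tendsto (fun k => (ρ k).rOut) atTop (𝓝 0) := by
    have h1 : Tendsto (fun k : ℕ => ((k : ℝ) + 2)) atTop atTop :=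
      tendsto_atTop_add_const_right _ _ tendsto_natCast_atTop_atTop
    simpa using (h1.const_div_atTop δ).const_mul 2
  have hK : ∀ x, ‖fderiv ℝ φ x‖ ≤ K := fun x => norm_fderiv_le_of_lipschitz ℝ hφ
  have hli : LocallyIntegrable (fderiv ℝ φ) (volume : Measure E) := by
    refine (locallyIntegrable_const (K : ℝ)).mono hfm.aestronglyMeasurable
      (Eventually.of_forall fun x => ?_)
    simpa using hK x
  have hae := ContDiffBump.ae_convolution_tendsto_right_of_locallyIntegrable
    (φ := ρ) (l := atTop) (K := 2) hρ0 (Eventually.of_forall fun k => le_rfl) hli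
  let ψ : ℕ → E → F := fun k => (ρ k).normed volume ⋆[lsmul ℝ ℝ, volume] φ
  have hψd : ∀ k x, fderiv ℝ (ψ k) x
      = ((ρ k).normed volume ⋆[lsmul ℝ ℝ, volume] fderiv ℝ φ) x := fun k x =>
    (hasFDerivAt_mollify (ρ k) hφ x).fderiv
  have hψs : ∀ k, ContDiff ℝ ∞ (ψ k) := fun k =>
    (ρ k).hasCompactSupport_normed.contDiff_convolution_left _ (ρ k).contDiff_normed
      hφ.continuous.locallyIntegrable
  have hψsupp : ∀ k, tsupport (ψ k) ⊆ Metric.cthickening δ (tsupport φ) := by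
    intro k
    refine closure_minimal ?_ Metric.isClosed_cthickening
    refine (support_convolution_subset _).trans ?_
    rw [(ρ k).support_normed_eq]
    rintro _ ⟨a, ha, b, hb, rfl⟩
    refine Metric.mem_cthickening_of_dist_le _ b _ _ (subset_tsupport _ hb) ?_
    have h1 : ‖a‖ < 2 * (δ / ((k : ℝ) + 2)) := by simpa [ρ] using ha
    have h2 : 2 * (δ / ((k : ℝ) + 2)) ≤ δ := by
      rw [mul_div_assoc', div_le_iff₀ (by positivity)]
      nlinarith [mul_nonneg hδ.le (Nat.cast_nonneg (α := ℝ) k)]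
    simpa using h1.le.trans h2
  have hψc : ∀ k, HasCompactSupport (ψ k) := fun k =>
    hc.isCompact.cthickening.of_isClosed_subset (isClosed_tsupport _) (hψsupp k)
  have hz : ∀ k, ∫ x in Ω, L x (fderiv ℝ (ψ k) x) = 0 := fun k =>
    h (ψ k) (hψs k) (hψc k) ((hψsupp k).trans hδΩ)
  have hb : ∀ k x, ‖fderiv ℝ (ψ k) x‖ ≤ K := by
    intro k x
    rw [hψd]
    have h1 : Integrable (fun t => (ρ k).normed volume t * (K : ℝ)) volume :=
      (ρ k).integrable_normed.mul_const _
    refine (norm_integral_le_of_norm_le h1 (Eventually.of_forall fun t => ?_)).trans_eq ?_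
    · rw [lsmul_apply, norm_smul, Real.norm_of_nonneg ((ρ k).nonneg_normed t)]
      exact mul_le_mul_of_nonneg_left (hK _) ((ρ k).nonneg_normed t)
    · rw [integral_mul_const, (ρ k).integral_normed, one_mul]
  have hlim : Tendsto (fun k => ∫ x in Ω, L x (fderiv ℝ (ψ k) x)) atTop
      (𝓝 (∫ x in Ω, L x (fderiv ℝ φ x))) := by
    refine tendsto_integral_of_dominated_convergence (fun _ => C) ?_ ?_ ?_ ?_
    · intro k
      exact hLm _ (stronglyMeasurable_fderiv _)
    · exact integrableOn_const hΩf
    · intro k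
      filter_upwards [ae_restrict_mem hΩ.measurableSet] with x hx using hC x hx _ (hb k x)
    · filter_upwards [ae_restrict_of_ae hae, ae_restrict_mem hΩ.measurableSet] with x hx hxΩ
      simp_rw [hψd]
      exact ((hLc x hxΩ).tendsto _).comp hx
  simp_rw [hz] at hlim
  refine ⟨?_, tendsto_nhds_unique hlim tendsto_const_nhds⟩
  refine Integrable.mono' (g := fun _ => C) (integrableOn_const hΩf) (hLm _ hfm) ?_
  filter_upwards [ae_restrict_mem hΩ.measurableSet] with x hx using hC x hx _ (hK x)

end Mollify

/-! ### Graph coordinates near the boundary -/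

section Chart

variable {E : Type*} [NormedAddCommGroup E] [InnerProductSpace ℝ E]

/-- The height of the graph of `γ` in direction `ν` above the point `x`. -/
noncomputable def chartHeight (ν : E) (γ : E → ℝ) (x : E) : ℝ :=
  γ (x - (inner ℝ ν x : ℝ) • ν) - inner ℝ ν x

variable {ν : E} {γ : E → ℝ}

theorem inner_self_of_unit (hν : ‖ν‖ = 1) : (inner ℝ ν ν : ℝ) = 1 := by
  rw [real_inner_self_eq_norm_sq, hν, one_pow]

theorem chartHeight_add_smul (hν : ‖ν‖ = 1) (x : E) (c : ℝ) :
    chartHeight ν γ (x + c • ν) = chartHeight ν γ x - c := by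
  have h : (inner ℝ ν (x + c • ν) : ℝ) = inner ℝ ν x + c := by
    rw [inner_add_right, inner_smul_right, inner_self_of_unit hν, mul_one]
  unfold chartHeight
  rw [h, add_smul, add_sub_add_right_eq_sub]
  ring

theorem inner_mem_orthogonal (z : (ℝ ∙ ν)ᗮ) : (inner ℝ ν (z : E) : ℝ) = 0 :=
  Submodule.mem_orthogonal_singleton_iff_inner_right.1 z.2

theorem chartHeight_orthogonal (z : (ℝ ∙ ν)ᗮ) : chartHeight ν γ z = γ z := by
  simp [chartHeight, inner_mem_orthogonal]

theorem chartHeight_graph (hν : ‖ν‖ = 1) (z : (ℝ ∙ ν)ᗮ) (t : ℝ) :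
    chartHeight ν γ ((z : E) + (γ z - t) • ν) = t := by
  rw [chartHeight_add_smul hν, chartHeight_orthogonal]
  ring

theorem exists_lipschitzWith_chartHeight (ν : E) {K : ℝ≥0} (hγ : LipschitzWith K γ) :
    ∃ K', LipschitzWith K' (chartHeight ν γ) := by
  have h : LipschitzWith _ (ContinuousLinearMap.id ℝ E - (innerSL ℝ ν).smulRight ν) :=
    ContinuousLinearMap.lipschitz _
  exact ⟨_, (hγ.comp h).sub (innerSL ℝ ν).lipschitz⟩

/-- Translation along `ν` changes the height only by a constant, so the derivative is constant on
each fibre and can be read off at its foot in the hyperplane. -/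
theorem hasFDerivAt_chartHeight_add_smul (hν : ‖ν‖ = 1) {x : E} {D : E →L[ℝ] ℝ}
    (h : HasFDerivAt (chartHeight ν γ) D x) (c : ℝ) :
    HasFDerivAt (chartHeight ν γ) D (x + c • ν) := by
  have h1 : HasFDerivAt (fun w : E => w - c • ν) (ContinuousLinearMap.id ℝ E) (x + c • ν) :=
    (hasFDerivAt_id _).sub_const _
  have h2 : HasFDerivAt (chartHeight ν γ) D (x + c • ν - c • ν) := by simpa using h
  have h3 := (h2.comp (x + c • ν) h1).sub_const c
  refine h3.congr_of_eventuallyEq (Eventually.of_forall fun w => ?_)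
  have := chartHeight_add_smul (γ := γ) hν (w - c • ν) c
  simpa using this

variable [FiniteDimensional ℝ E] [MeasurableSpace E] [BorelSpace E]

/-- Rademacher on the whole space says nothing on the hyperplane, a null set; it is applied to `γ`
restricted to the hyperplane and composed with the orthogonal projection. -/
theorem ae_differentiableAt_chartHeight (hν : ‖ν‖ = 1) {K : ℝ≥0} (hγ : LipschitzWith K γ) :
    ∀ᵐ z : (ℝ ∙ ν)ᗮ, DifferentiableAt ℝ (chartHeight ν γ) (z : E) := by
  have h1 : LipschitzWith (K * 1) (fun z : (ℝ ∙ ν)ᗮ => γ z) :=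
    hγ.comp (LipschitzWith.subtype_val _)
  filter_upwards [h1.ae_differentiableAt (μ := volume)] with z hz
  let π : E →L[ℝ] (ℝ ∙ ν)ᗮ :=
    (ContinuousLinearMap.id ℝ E - (innerSL ℝ ν).smulRight ν).codRestrict (ℝ ∙ ν)ᗮ fun x => by
      rw [Submodule.mem_orthogonal_singleton_iff_inner_right]
      simp [inner_sub_right, inner_smul_right, hν]
  have hπ : ∀ x : E, ((π x : (ℝ ∙ ν)ᗮ) : E) = x - (inner ℝ ν x : ℝ) • ν := fun x => rfl
  have hπz : π z = z := Subtype.ext (by rw [hπ, inner_mem_orthogonal]; simp)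
  rw [← hπz] at hz
  have h2 : DifferentiableAt ℝ (fun x : E => γ (π x) - innerSL ℝ ν x) z :=
    (DifferentiableAt.comp (g := fun z : (ℝ ∙ ν)ᗮ => γ z) (z : E) hz π.differentiableAt).sub
      (innerSL ℝ ν).differentiableAt
  exact h2

/-- Coordinates adapted to the graph of `γ` are measure preserving up to a constant factor. -/
theorem integral_eq_mul_integral_graph (hν : ‖ν‖ = 1) (hγ : Continuous γ) {ε : ℝ} (hε : 0 < ε)
    {g : E → ℝ} (hg : Measurable g) :
    ∫ x, g x = ε * ∫ p : (ℝ ∙ ν)ᗮ × ℝ, g ((p.1 : E) + (γ p.1 - ε * p.2) • ν) := by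
  have hm1 : MeasurePreserving (fun p : ℝ × (ℝ ∙ ν)ᗮ => (p.2 : E) + p.1 • ν)
      (volume.prod volume) volume := by
    have h1 := (LinearIsometryEquiv.toSpanUnitSingleton (𝕜 := ℝ) ν hν).measurePreserving
    have h2 : MeasurePreserving (fun z : (ℝ ∙ ν)ᗮ => z) volume volume := MeasurePreserving.id _
    have h3 := (ℝ ∙ ν).orthogonalDecomposition.symm.measurePreserving.comp
      ((WithLp.volume_preserving_toLp (ℝ ∙ ν) (ℝ ∙ ν)ᗮ).comp (h1.prod h2))
    convert! h3 using 1
    ext p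
    simp [add_comm]
  -- On each fibre this is a scaling by `ε`, a reflection and a translation, hence the factor `ε` on
  -- Lebesgue measure.
  have hm2 : MeasurePreserving (fun p : (ℝ ∙ ν)ᗮ × ℝ => (p.1, γ p.1 - ε * p.2))
      (volume.prod (ENNReal.ofReal ε • volume)) (volume.prod volume) := by
    refine MeasurePreserving.skew_product (f := fun z : (ℝ ∙ ν)ᗮ => z)
      (g := fun (z : (ℝ ∙ ν)ᗮ) t => γ z - ε * t) (MeasurePreserving.id _) ?_ ?_
    · have : Continuous fun p : (ℝ ∙ ν)ᗮ × ℝ => γ p.1 - ε * p.2 := by fun_prop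
      exact this.measurable
    · refine Eventually.of_forall fun z => ?_
      have h1 := (Measure.measurePreserving_sub_left (volume : Measure ℝ) (γ z)).map_eq
      have h2 := Real.smul_map_volume_mul_left hε.ne'
      rw [abs_of_pos hε] at h2
      have h3 := Measure.map_map (μ := ENNReal.ofReal ε • (volume : Measure ℝ))
        (measurable_const_sub (γ z)) (measurable_const_mul ε)
      rw [Measure.map_smul, h2, h1] at h3
      exact h3.symm
  have hm := (hm1.comp Measure.measurePreserving_swap).comp hm2
  rw [← hm.map_eq, integral_map hm.measurable.aemeasurable hg.aestronglyMeasurable,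
    Measure.prod_smul_right, integral_smul_measure, ENNReal.toReal_ofReal hε.le, smul_eq_mul]
  rfl

end Chart

/-! ### A smooth step function -/

section Cutoff

/-- A smooth monotone step, equal to `0` on `(-∞, 1]` and to `1` on `[2, ∞)`. -/
noncomputable def step (u : ℝ) : ℝ := Real.smoothTransition (u - 1)

theorem contDiff_step : ContDiff ℝ ∞ step :=
  Real.smoothTransition.contDiff.comp (contDiff_id.sub contDiff_const)

theorem step_nonneg (u : ℝ) : 0 ≤ step u := Real.smoothTransition.nonneg _

theorem step_le_one (u : ℝ) : step u ≤ 1 := Real.smoothTransition.le_one _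

theorem step_of_le {u : ℝ} (h : u ≤ 1) : step u = 0 :=
  Real.smoothTransition.zero_of_nonpos (by linarith)

theorem step_of_ge {u : ℝ} (h : 2 ≤ u) : step u = 1 :=
  Real.smoothTransition.one_of_one_le (by linarith)

theorem monotone_step : Monotone step := fun _ _ h =>
  Real.smoothTransition.monotone (by linarith)

theorem deriv_step_nonneg (u : ℝ) : 0 ≤ deriv step u := monotone_step.deriv_nonneg

theorem hasDerivAt_step (u : ℝ) : HasDerivAt step (deriv step u) u :=
  ((contDiff_step.differentiable (by simp)) u).hasDerivAt

theorem continuous_deriv_step : Continuous (deriv step) :=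
  contDiff_step.continuous_deriv (by simp)

theorem deriv_step_of_notMem {u : ℝ} (h : u ∉ Icc (1 : ℝ) 2) : deriv step u = 0 := by
  rw [mem_Icc, not_and_or, not_le, not_le] at h
  rcases h with h | h
  · have : step =ᶠ[𝓝 u] fun _ => 0 := by
      filter_upwards [Iio_mem_nhds h] with v hv using step_of_le (le_of_lt hv)
    rw [this.deriv_eq, deriv_const]
  · have : step =ᶠ[𝓝 u] fun _ => 1 := by
      filter_upwards [Ioi_mem_nhds h] with v hv using step_of_ge (le_of_lt hv)
    rw [this.deriv_eq, deriv_const]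

theorem exists_deriv_step_le : ∃ M : ℝ≥0, ∀ u, deriv step u ≤ M := by
  obtain ⟨M, hM⟩ := (isCompact_Icc (a := (1 : ℝ)) (b := 2)).exists_bound_of_continuousOn
    continuous_deriv_step.continuousOn
  refine ⟨M.toNNReal, fun u => ?_⟩
  by_cases hu : u ∈ Icc (1 : ℝ) 2
  · exact (le_abs_self _).trans ((hM u hu).trans (Real.le_coe_toNNReal _))
  · rw [deriv_step_of_notMem hu]; exact NNReal.coe_nonneg _

theorem exists_lipschitzWith_step : ∃ M, LipschitzWith M step := by
  obtain ⟨M, hM⟩ := exists_deriv_step_le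
  refine ⟨M, lipschitzWith_of_nnnorm_deriv_le (contDiff_step.differentiable (by simp)) fun u => ?_⟩
  rw [← NNReal.coe_le_coe, coe_nnnorm, Real.norm_of_nonneg (deriv_step_nonneg u)]
  exact hM u

end Cutoff

/-! ### Lipschitz products -/

section Lipschitz

variable {X F : Type*} [PseudoMetricSpace X] [NormedAddCommGroup F] [NormedSpace ℝ F]

/-- The product of a Lipschitz function with compact support and a Lipschitz map is Lipschitz. -/
theorem exists_lipschitzWith_smul {χ : X → ℝ} {v : X → F} {K K' : ℝ≥0} (hχ : LipschitzWith K χ)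
    (hc : HasCompactSupport χ) (hv : LipschitzWith K' v) :
    ∃ C, LipschitzWith C fun x => χ x • v x := by
  obtain ⟨A, hA⟩ := hχ.continuous.bounded_above_of_compact_support hc
  obtain ⟨B, hB⟩ := IsCompact.exists_bound_of_continuousOn hc hv.continuous.continuousOn
  -- `v` is bounded only on the support of `χ`, so the difference is split with the undifferenced
  -- `v` at the point lying there.
  have key : ∀ x y, x ∈ tsupport χ →
      dist (χ x • v x) (χ y • v y) ≤ (K * B.toNNReal + A.toNNReal * K' : ℝ≥0) * dist x y := by
    intro x y hx
    have h1 : χ x • v x - χ y • v y = (χ x - χ y) • v x + χ y • (v x - v y) := by module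
    rw [dist_eq_norm, h1]
    refine (norm_add_le _ _).trans ?_
    rw [norm_smul, norm_smul]
    have h2 : ‖χ x - χ y‖ ≤ K * dist x y := by
      simpa [dist_eq_norm] using hχ.dist_le_mul x y
    have h3 : ‖v x - v y‖ ≤ K' * dist x y := by
      simpa [dist_eq_norm] using hv.dist_le_mul x y
    have h4 : ‖v x‖ ≤ B.toNNReal := (hB x hx).trans (Real.le_coe_toNNReal _)
    have h5 : ‖χ y‖ ≤ A.toNNReal := (hA y).trans (Real.le_coe_toNNReal _)
    calc _ ≤ (K * dist x y) * B.toNNReal + A.toNNReal * (K' * dist x y) := by gcongr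
      _ = _ := by push_cast; ring
  refine ⟨K * B.toNNReal + A.toNNReal * K', LipschitzWith.of_dist_le_mul fun x y => ?_⟩
  by_cases hx : x ∈ tsupport χ
  · exact key x y hx
  · by_cases hy : y ∈ tsupport χ
    · rw [dist_comm, dist_comm x]; exact key y x hy
    · rw [image_eq_zero_of_notMem_tsupport hx, image_eq_zero_of_notMem_tsupport hy, zero_smul,
        zero_smul, dist_self]
      positivity

end Lipschitz

/-! ### Weak divergence and boundary layers -/

section Divergence

variable {E : Type*} [NormedAddCommGroup E] [InnerProductSpace ℝ E] [FiniteDimensional ℝ E]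
  [MeasurableSpace E] [BorelSpace E]

/-- `G` is a bounded field on `Ω` whose weak divergence is the bounded function `f`. -/
structure HasWeakDiv (Ω : Set E) (G : E → E) (f : E → ℝ) (C : ℝ) : Prop where
  nonneg : 0 ≤ C
  measurable_field : Measurable G
  measurable_div : Measurable f
  field_le : ∀ x ∈ Ω, ‖G x‖ ≤ C
  div_le : ∀ x ∈ Ω, |f x| ≤ C
  integral_eq_zero : ∀ (χ : E → ℝ) (K : ℝ≥0), LipschitzWith K χ → HasCompactSupport χ →
    tsupport χ ⊆ Ω → ∫ x in Ω, (f x * χ x + fderiv ℝ χ x (G x)) = 0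

variable {Ω : Set E} {G : E → E} {f : E → ℝ} {C : ℝ}

theorem measurable_fderiv_apply_field (χ : E → ℝ) (hG : Measurable G) :
    Measurable fun x => fderiv ℝ χ x (G x) := by
  borelize (E →L[ℝ] ℝ)
  exact (continuous_fst.clm_apply continuous_snd).measurable.comp
    ((measurable_fderiv ℝ χ).prodMk hG)

theorem HasWeakDiv.norm_le (h : HasWeakDiv Ω G f C) {χ : E → ℝ} {K : ℝ≥0}
    (hχ : LipschitzWith K χ) {M : ℝ} (hM : ∀ x, ‖χ x‖ ≤ M) {x : E} (hx : x ∈ Ω) :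
    ‖f x * χ x + fderiv ℝ χ x (G x)‖ ≤ C * M + K * C := by
  refine (norm_add_le _ _).trans (add_le_add ?_ ?_)
  · rw [norm_mul]
    exact mul_le_mul (h.div_le x hx) (hM x) (norm_nonneg _) ((abs_nonneg _).trans (h.div_le x hx))
  · exact (le_opNorm _ _).trans (mul_le_mul (norm_fderiv_le_of_lipschitz ℝ hχ) (h.field_le x hx)
      (norm_nonneg _) K.coe_nonneg)

theorem HasWeakDiv.measurable (h : HasWeakDiv Ω G f C) {χ : E → ℝ} (hχ : Continuous χ) :
    Measurable fun x => f x * χ x + fderiv ℝ χ x (G x) :=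
  (h.measurable_div.mul hχ.measurable).add (measurable_fderiv_apply_field χ h.measurable_field)

theorem HasWeakDiv.integrable (h : HasWeakDiv Ω G f C) (hΩ : IsOpen Ω)
    (hΩf : volume Ω ≠ ⊤) {χ : E → ℝ} {K : ℝ≥0} (hχ : LipschitzWith K χ) {M : ℝ}
    (hM : ∀ x, ‖χ x‖ ≤ M) :
    IntegrableOn (fun x => f x * χ x + fderiv ℝ χ x (G x)) Ω := by
  refine Integrable.mono' (g := fun _ => C * M + K * C) (integrableOn_const hΩf)
    (h.measurable hχ.continuous).aestronglyMeasurable ?_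
  filter_upwards [ae_restrict_mem hΩ.measurableSet] with x hx using h.norm_le hχ hM hx

/-- Chart condition: near the boundary part in `U`, the set `Ω` lies below the graph of `γ`, and the
continuous boundary values `G'` of `G` point inwards on almost all of the graph. -/
structure InwardChart (Ω : Set E) (G : E → E) (U : Set E) (ν : E) (γ : E → ℝ) (K : ℝ≥0)
    (G' : E → E) : Prop where
  isOpen : IsOpen U
  unit : ‖ν‖ = 1
  lipschitz : LipschitzWith K γ
  mem_iff : ∀ x ∈ U, (x ∈ Ω ↔ 0 < chartHeight ν γ x)
  continuousOn : ContinuousOn G' (closure Ω ∩ U)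
  eqOn : EqOn G' G (Ω ∩ U)
  inward : ∀ᵐ z : (ℝ ∙ ν)ᗮ, (z : E) + γ z • ν ∈ U →
    0 ≤ fderiv ℝ (chartHeight ν γ) z (G' ((z : E) + γ z • ν))

/-- The boundary layer integrals converge to a non-negative limit. -/
theorem InwardChart.tendsto_layer {U : Set E} {ν : E} {γ : E → ℝ} {K : ℝ≥0} {G' : E → E}
    (hU : InwardChart Ω G U ν γ K G') (hG : Measurable G) (hC : 0 ≤ C)
    (hGC : ∀ x ∈ Ω, ‖G x‖ ≤ C)
    {ψ : E → ℝ} (hψ : Continuous ψ) (hψc : HasCompactSupport ψ) (hψU : tsupport ψ ⊆ U)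
    (hψ0 : ∀ x, 0 ≤ ψ x) {ε : ℕ → ℝ} (hε : ∀ k, 0 < ε k) (hε0 : Tendsto ε atTop (𝓝 0)) :
    ∃ l : ℝ, 0 ≤ l ∧ Tendsto (fun k => ∫ x, ψ x * (deriv step (chartHeight ν γ x / ε k) / ε k *
      fderiv ℝ (chartHeight ν γ) x (G x))) atTop (𝓝 l) := by
  obtain ⟨K', hs⟩ := exists_lipschitzWith_chartHeight ν hU.lipschitz
  have hν := hU.unit
  set s := chartHeight ν γ
  obtain ⟨M, hM⟩ := exists_deriv_step_le
  obtain ⟨A, hA⟩ := hψ.bounded_above_of_compact_support hψc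
  have hA0 : 0 ≤ A := (norm_nonneg _).trans (hA 0)
  obtain ⟨R, hR⟩ := hψc.isBounded.exists_norm_le
  let P : ℕ → (ℝ ∙ ν)ᗮ × ℝ → E := fun k p => (p.1 : E) + (γ p.1 - ε k * p.2) • ν
  have hPc : ∀ k, Continuous (P k) := fun k => by
    have := hU.lipschitz.continuous
    fun_prop
  have hsP : ∀ k p, s (P k p) = ε k * p.2 := fun k p => chartHeight_graph hν _ _
  have hmeas : ∀ k, Measurable fun x => ψ x * (deriv step (s x / ε k) / ε k *
      fderiv ℝ s x (G x)) := fun k => by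
    have h1 : Continuous fun x => deriv step (s x / ε k) / ε k :=
      (continuous_deriv_step.comp (hs.continuous.div_const _)).div_const _
    exact hψ.measurable.mul (h1.measurable.mul (measurable_fderiv_apply_field s hG))
  -- In the rescaled coordinate the shrinking layer `ε ≤ s ≤ 2ε` becomes the fixed slab `1 ≤ p.2 ≤
  -- 2`, and the Jacobian `ε` cancels the `1/ε` from differentiating the cutoff.
  let Φ : ℕ → (ℝ ∙ ν)ᗮ × ℝ → ℝ := fun k p =>
    ψ (P k p) * (deriv step p.2 * fderiv ℝ s (P k p) (G (P k p)))
  let Q : (ℝ ∙ ν)ᗮ → E := fun z => (z : E) + γ z • ν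
  let Φ0 : (ℝ ∙ ν)ᗮ × ℝ → ℝ := fun p =>
    ψ (Q p.1) * (deriv step p.2 * fderiv ℝ s p.1 (G' (Q p.1)))
  have hint : ∀ k, ∫ x, ψ x * (deriv step (s x / ε k) / ε k * fderiv ℝ s x (G x))
      = ∫ p, Φ k p := by
    intro k
    rw [integral_eq_mul_integral_graph hν hU.lipschitz.continuous (hε k) (hmeas k),
      ← integral_const_mul]
    refine integral_congr_ae (Eventually.of_forall fun p => ?_)
    change ε k * (ψ (P k p) * (deriv step (s (P k p) / ε k) / ε k *
      fderiv ℝ s (P k p) (G (P k p)))) = _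
    rw [hsP, mul_div_cancel_left₀ _ (hε k).ne']
    have := (hε k).ne'
    simp only [Φ]
    field_simp
  have hdiff : ∀ᵐ p : (ℝ ∙ ν)ᗮ × ℝ, DifferentiableAt ℝ s (p.1 : E) ∧
      (Q p.1 ∈ U → 0 ≤ fderiv ℝ s p.1 (G' (Q p.1))) :=
    (Measure.quasiMeasurePreserving_fst (μ := (volume : Measure (ℝ ∙ ν)ᗮ))
      (ν := (volume : Measure ℝ))).ae
      ((ae_differentiableAt_chartHeight hν hU.lipschitz).and hU.inward)
  refine ⟨∫ p, Φ0 p, integral_nonneg_of_ae ?_, ?_⟩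
  · filter_upwards [hdiff] with p hp
    by_cases hq : Q p.1 ∈ U
    · exact mul_nonneg (hψ0 _) (mul_nonneg (deriv_step_nonneg _) (hp.2 hq))
    · simp [Φ0, image_eq_zero_of_notMem_tsupport fun h => hq (hψU h)]
  simp_rw [hint]
  have hmem : ∀ k p, P k p ∈ U → 0 < p.2 → P k p ∈ Ω := fun k p hp h0 =>
    (hU.mem_iff _ hp).2 (by change 0 < s _; rw [hsP]; exact mul_pos (hε k) h0)
  refine tendsto_integral_of_dominated_convergence
    (fun p => indicator (Metric.closedBall (0 : (ℝ ∙ ν)ᗮ) R ×ˢ Icc (1 : ℝ) 2)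
      (fun _ => A * (M * (K' * C))) p) ?_ ?_ ?_ ?_
  · intro k
    have h1 : Measurable fun p : (ℝ ∙ ν)ᗮ × ℝ => ψ (P k p) :=
      (hψ.comp (hPc k)).measurable
    have h2 : Measurable fun p : (ℝ ∙ ν)ᗮ × ℝ => deriv step p.2 :=
      (continuous_deriv_step.comp continuous_snd).measurable
    exact (h1.mul (h2.mul ((measurable_fderiv_apply_field s hG).comp
      (hPc k).measurable))).aestronglyMeasurable
  · refine (integrable_indicator_iff ?_).2 (integrableOn_const ?_)
    · exact (Metric.isClosed_closedBall.prod isClosed_Icc).measurableSet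
    · exact ((isCompact_closedBall _ _).prod isCompact_Icc).measure_lt_top.ne
  · intro k
    refine Eventually.of_forall fun p => ?_
    by_cases h2 : p.2 ∈ Icc (1 : ℝ) 2
    · by_cases h1 : P k p ∈ tsupport ψ
      · have hR1 : ‖(p.1 : E)‖ ≤ R := by
          refine le_trans ?_ (hR _ h1)
          have : ‖(p.1 : E)‖ ^ 2 ≤ ‖P k p‖ ^ 2 := by
            rw [norm_add_sq_real, inner_smul_right, real_inner_comm, inner_mem_orthogonal]
            nlinarith [sq_nonneg ‖(γ p.1 - ε k * p.2) • ν‖]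
          exact le_of_sq_le_sq this (norm_nonneg _)
        have hΩ : P k p ∈ Ω := hmem k p (hψU h1) (by linarith [h2.1])
        rw [indicator_of_mem (show p ∈ Metric.closedBall (0 : (ℝ ∙ ν)ᗮ) R ×ˢ Icc (1 : ℝ) 2 from
          ⟨by simpa using hR1, h2⟩)]
        rw [norm_mul, norm_mul]
        refine mul_le_mul (hA _) (mul_le_mul ?_ ?_ (norm_nonneg _) M.coe_nonneg)
          (by positivity) hA0
        · rw [Real.norm_of_nonneg (deriv_step_nonneg _)]; exact hM _
        · exact (le_opNorm _ _).trans (mul_le_mul (norm_fderiv_le_of_lipschitz ℝ hs)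
            (hGC _ hΩ) (norm_nonneg _) K'.coe_nonneg)
      · simp only [Φ, image_eq_zero_of_notMem_tsupport h1, zero_mul, norm_zero]
        exact indicator_nonneg (fun _ _ => by positivity) _
    · rw [indicator_of_notMem fun h => h2 h.2]
      simp [Φ, deriv_step_of_notMem h2]
  · filter_upwards [hdiff] with p hp
    have hPQ : Tendsto (fun k => P k p) atTop (𝓝 (Q p.1)) := by
      have : Tendsto (fun k => (p.1 : E) + (γ p.1 - ε k * p.2) • ν) atTop
          (𝓝 ((p.1 : E) + (γ p.1 - 0 * p.2) • ν)) :=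
        (((hε0.mul_const _).const_sub _).smul_const _).const_add _
      simpa using this
    by_cases h2 : p.2 ∈ Icc (1 : ℝ) 2
    swap
    · simp [Φ, Φ0, deriv_step_of_notMem h2]
    have hp2 : 0 < p.2 := by linarith [h2.1]
    by_cases hq : Q p.1 ∈ U
    · have hev : ∀ᶠ k in atTop, P k p ∈ Ω ∩ U := by
        filter_upwards [hPQ.eventually (hU.isOpen.mem_nhds hq)] with k hk
          using ⟨hmem k p hk hp2, hk⟩
      have hcl : Q p.1 ∈ closure Ω ∩ U :=
        ⟨mem_closure_of_tendsto hPQ (hev.mono fun k hk => hk.1), hq⟩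
      have hG' : Tendsto (fun k => G' (P k p)) atTop (𝓝 (G' (Q p.1))) :=
        (hU.continuousOn _ hcl).tendsto.comp
          (tendsto_nhdsWithin_iff.2 ⟨hPQ, hev.mono fun k hk => ⟨subset_closure hk.1, hk.2⟩⟩)
      have hlim : Tendsto (fun k => ψ (P k p) * (deriv step p.2 * fderiv ℝ s p.1 (G' (P k p))))
          atTop (𝓝 (Φ0 p)) :=
        ((hψ.tendsto _).comp hPQ).mul
          ((((fderiv ℝ s (p.1 : E)).continuous.tendsto _).comp hG').const_mul _)
      refine hlim.congr' ?_
      filter_upwards [hev] with k hk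
      -- The height derivative is constant along the fibre, so the limit needs continuity of `G'`
      -- only and none of the gradient of `γ`.
      have : fderiv ℝ s (P k p) = fderiv ℝ s (p.1 : E) :=
        (hasFDerivAt_chartHeight_add_smul hν hp.1.hasFDerivAt _).fderiv
      simp only [Φ]
      rw [this, hU.eqOn hk]
    · have hq' : Q p.1 ∉ tsupport ψ := fun h => hq (hψU h)
      have hev : ∀ᶠ k in atTop, P k p ∉ tsupport ψ :=
        hPQ.eventually ((isClosed_tsupport ψ).isOpen_compl.mem_nhds hq')
      have h0 : Φ0 p = 0 := by simp [Φ0, image_eq_zero_of_notMem_tsupport hq']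
      rw [h0]
      refine tendsto_const_nhds.congr' ?_
      filter_upwards [hev] with k hk
      simp [Φ, image_eq_zero_of_notMem_tsupport hk]

end Divergence

/-! ### The divergence inequality, in a chart and globally -/

section Divergence

variable {E : Type*} [NormedAddCommGroup E] [InnerProductSpace ℝ E] [FiniteDimensional ℝ E]
  [MeasurableSpace E] [BorelSpace E] {Ω : Set E} {G : E → E} {f : E → ℝ} {C : ℝ}

/-- The divergence inequality localized to a boundary chart. -/
theorem HasWeakDiv.integral_nonpos_of_chart (h : HasWeakDiv Ω G f C) (hΩ : IsOpen Ω)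
    (hΩf : volume Ω ≠ ⊤) {U : Set E} {ν : E} {γ : E → ℝ} {K : ℝ≥0} {G' : E → E}
    (hU : InwardChart Ω G U ν γ K G') {ψ : E → ℝ} {Kψ : ℝ≥0} (hψ : LipschitzWith Kψ ψ)
    (hψc : HasCompactSupport ψ) (hψU : tsupport ψ ⊆ U) (hψ0 : ∀ x, 0 ≤ ψ x) :
    ∫ x in Ω, (f x * ψ x + fderiv ℝ ψ x (G x)) ≤ 0 := by
  obtain ⟨K', hs⟩ := exists_lipschitzWith_chartHeight ν hU.lipschitz
  obtain ⟨M, hM⟩ := exists_lipschitzWith_step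
  obtain ⟨A, hA⟩ := hψ.continuous.bounded_above_of_compact_support hψc
  let ε : ℕ → ℝ := fun k => 1 / ((k : ℝ) + 1)
  have hε : ∀ k, 0 < ε k := fun k => by positivity
  have hε0 : Tendsto ε atTop (𝓝 0) := tendsto_one_div_add_atTop_nhds_zero_nat
  obtain ⟨l, hl0, hl⟩ := hU.tendsto_layer h.measurable_field h.nonneg h.field_le hψ.continuous hψc
    hψU hψ0 hε hε0
  set s := chartHeight ν γ
  let g : ℕ → E → ℝ := fun k x =>
    ψ x * (deriv step (s x / ε k) / ε k * fderiv ℝ s x (G x))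
  let b : E → ℝ := fun x => f x * ψ x + fderiv ℝ ψ x (G x)
  have hb : IntegrableOn b Ω := h.integrable hΩ hΩf hψ hA
  have hb0 : ∀ x, x ∉ tsupport ψ → b x = 0 := fun x hx => by
    have h1 : fderiv ℝ ψ x = 0 := Function.notMem_support.1 fun h => hx (support_fderiv_subset ℝ h)
    simp [b, h1, image_eq_zero_of_notMem_tsupport hx]
  have hθ : ∀ k, Continuous fun x => step (s x / ε k) := fun k =>
    hM.continuous.comp (hs.continuous.div_const _)
  have hbθ : ∀ k, IntegrableOn (fun x => step (s x / ε k) * b x) Ω := fun k =>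
    hb.bdd_mul (c := 1) (hθ k).aestronglyMeasurable (Eventually.of_forall fun x => by
      rw [Real.norm_of_nonneg (step_nonneg _)]; exact step_le_one _)
  -- The test function `ψ · step (s / ε)` vanishes where `s < ε`, hence is supported in `Ω` and
  -- admissible. Differentiating the cutoff factor produces the layer term `g k`, whose limit is
  -- non-negative; the remaining term tends to `∫ b`.
  have hzero : ∀ k, ∫ x, g k x = - ∫ x in Ω, step (s x / ε k) * b x := by
    intro k
    have hθL : LipschitzWith (M * (K' * ‖(ε k)⁻¹‖₊)) fun x => step (s x / ε k) := by
      refine hM.comp (LipschitzWith.of_dist_le_mul fun x y => ?_)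
      have := hs.dist_le_mul x y
      rw [Real.dist_eq, ← sub_div, div_eq_mul_inv, abs_mul]
      rw [Real.dist_eq] at this
      push_cast
      rw [Real.norm_eq_abs, mul_right_comm]
      exact mul_le_mul_of_nonneg_right this (abs_nonneg _)
    obtain ⟨Kχ, hχ⟩ := exists_lipschitzWith_smul hψ hψc hθL
    have hsupp : tsupport (fun x => ψ x • step (s x / ε k)) ⊆ tsupport ψ ∩ {x | ε k ≤ s x} := by
      refine closure_minimal (fun x hx => ?_)
        ((isClosed_tsupport ψ).inter (isClosed_le continuous_const hs.continuous))
      rw [Function.mem_support, smul_eq_mul] at hx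
      refine ⟨subset_tsupport _ (left_ne_zero_of_mul hx), ?_⟩
      by_contra hlt
      refine right_ne_zero_of_mul hx (step_of_le ?_)
      rw [div_le_one (hε k)]
      exact le_of_lt (not_le.1 hlt)
    have hχc : HasCompactSupport (fun x => ψ x • step (s x / ε k)) :=
      IsCompact.of_isClosed_subset hψc (isClosed_tsupport _) (hsupp.trans inter_subset_left)
    have hχΩ : tsupport (fun x => ψ x • step (s x / ε k)) ⊆ Ω := fun x hx =>
      (hU.mem_iff x (hψU (hsupp hx).1)).2 ((hε k).trans_le (hsupp hx).2)
    have h0 := h.integral_eq_zero _ _ hχ hχc hχΩ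
    have hsplit : (fun x => f x * (ψ x • step (s x / ε k)) +
        fderiv ℝ (fun x => ψ x • step (s x / ε k)) x (G x))
        =ᵐ[volume.restrict Ω] fun x => step (s x / ε k) * b x + g k x := by
      filter_upwards [ae_restrict_of_ae (hψ.ae_differentiableAt (μ := volume)),
        ae_restrict_of_ae (hs.ae_differentiableAt (μ := volume))] with x h1 h2
      have h3 : HasFDerivAt (fun x => step (s x / ε k))
          ((deriv step (s x / ε k)) • ((ε k)⁻¹ • fderiv ℝ s x)) x := by
        refine (hasDerivAt_step _).comp_hasFDerivAt x ?_
        simpa [div_eq_mul_inv] using h2.hasFDerivAt.mul_const (ε k)⁻¹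
      have h4 : HasFDerivAt (fun x => ψ x • step (s x / ε k)) _ x := h1.hasFDerivAt.smul h3
      rw [h4.fderiv]
      simp [b, g]
      ring
    rw [integral_congr_ae hsplit] at h0
    have hχi := (h.integrable hΩ hΩf hχ (M := A) fun x => by
      rw [norm_smul, Real.norm_of_nonneg (step_nonneg _)]
      exact (mul_le_of_le_one_right (norm_nonneg _) (step_le_one _)).trans (hA x)).congr hsplit
    have hgi : IntegrableOn (g k) Ω := by
      refine (hχi.sub (hbθ k)).congr (Eventually.of_forall fun x => ?_)
      simp
    rw [integral_add (hbθ k) hgi] at h0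
    have hgΩ : ∫ x in Ω, g k x = ∫ x, g k x := by
      refine setIntegral_eq_integral_of_forall_compl_eq_zero fun x hx => ?_
      by_cases hxψ : x ∈ tsupport ψ
      · have hsx : s x ≤ 0 := not_lt.1 fun h' => hx ((hU.mem_iff x (hψU hxψ)).2 h')
        have : deriv step (s x / ε k) = 0 := deriv_step_of_notMem fun hmem => by
          have := div_nonpos_of_nonpos_of_nonneg hsx (hε k).le
          linarith [hmem.1]
        simp [g, this]
      · simp [g, image_eq_zero_of_notMem_tsupport hxψ]
    linarith
  have hlim : Tendsto (fun k => ∫ x in Ω, step (s x / ε k) * b x) atTop (𝓝 (∫ x in Ω, b x)) := by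
    refine tendsto_integral_of_dominated_convergence (fun x => ‖b x‖)
      (fun k => (hbθ k).aestronglyMeasurable) hb.norm (fun k => ?_) ?_
    · refine Eventually.of_forall fun x => ?_
      rw [norm_mul, Real.norm_of_nonneg (step_nonneg _)]
      exact mul_le_of_le_one_left (norm_nonneg _) (step_le_one _)
    · filter_upwards [ae_restrict_mem hΩ.measurableSet] with x hx
      by_cases hxψ : x ∈ tsupport ψ
      · have hsx : 0 < s x := (hU.mem_iff x (hψU hxψ)).1 hx
        refine tendsto_const_nhds.congr' ?_
        have : ∀ᶠ k in atTop, ε k < s x / 2 := hε0.eventually (Iio_mem_nhds (by positivity))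
        filter_upwards [this] with k hk
        rw [step_of_ge, one_mul]
        rw [le_div_iff₀ (hε k)]
        linarith
      · simp [hb0 x hxψ]
  have hlim2 : Tendsto (fun k => ∫ x, g k x) atTop (𝓝 (-∫ x in Ω, b x)) := by
    simp_rw [hzero]
    exact hlim.neg
  have := tendsto_nhds_unique hl hlim2
  change ∫ x in Ω, b x ≤ 0
  linarith

/-- Divergence inequality on Lipschitz domains: if the boundary values of a field point inwards
then the integral of its divergence is non-positive. -/
theorem HasWeakDiv.integral_nonpos (h : HasWeakDiv Ω G f C) (hΩ : IsOpen Ω)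
    (hΩb : Bornology.IsBounded Ω)
    (hch : ∀ p ∈ frontier Ω, ∃ U ν γ K G', p ∈ U ∧ InwardChart Ω G U ν γ K G') :
    ∫ x in Ω, f x ≤ 0 := by
  have hΩf : volume Ω ≠ ⊤ := hΩb.measure_lt_top.ne
  -- `T U` is the inequality for non-negative tests supported in `U`. It holds for `Ω` itself and
  -- for each boundary chart, and a partition of unity then adds up the local inequalities.
  let T : Set E → Prop := fun U => IsOpen U ∧ ∀ (ψ : E → ℝ) (K : ℝ≥0), LipschitzWith K ψ →
    HasCompactSupport ψ → tsupport ψ ⊆ U → (∀ x, 0 ≤ ψ x) →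
    ∫ x in Ω, (f x * ψ x + fderiv ℝ ψ x (G x)) ≤ 0
  have hloc : ∀ p ∈ closure Ω, ∃ U, p ∈ U ∧ T U := by
    intro p hp
    by_cases hpΩ : p ∈ Ω
    · exact ⟨Ω, hpΩ, hΩ, fun ψ K h1 h2 h3 _ => (h.integral_eq_zero ψ K h1 h2 h3).le⟩
    · obtain ⟨U, ν, γ, K, G', hpU, hU⟩ := hch p ⟨hp, by rwa [hΩ.interior_eq]⟩
      exact ⟨U, hpU, hU.isOpen, fun ψ K h1 h2 h3 h4 =>
        h.integral_nonpos_of_chart hΩ hΩf hU h1 h2 h3 h4⟩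
  choose! V hpV hV using hloc
  have hcomp : IsCompact (closure Ω) := hΩb.isCompact_closure
  -- Intersecting with unit balls makes the partition functions compactly supported.
  obtain ⟨t, ht⟩ := hcomp.elim_finite_subcover (fun p : closure Ω => V p ∩ Metric.ball (p : E) 1)
    (fun p => (hV p p.2).1.inter Metric.isOpen_ball) fun p hp =>
      mem_iUnion.2 ⟨⟨p, hp⟩, hpV p hp, Metric.mem_ball_self one_pos⟩
  have hcov : closure Ω ⊆ ⋃ i : t, V (i : closure Ω) ∩ Metric.ball ((i : closure Ω) : E) 1 := by
    intro x hx
    obtain ⟨i, hi, hxi⟩ := mem_iUnion₂.1 (ht hx)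
    exact mem_iUnion.2 ⟨⟨i, hi⟩, hxi⟩
  obtain ⟨ρ, hρ⟩ := SmoothPartitionOfUnity.exists_isSubordinate (modelWithCornersSelf ℝ E)
    isClosed_closure (fun i : t => V (i : closure Ω) ∩ Metric.ball ((i : closure Ω) : E) 1)
    (fun i => (hV _ i.1.2).1.inter Metric.isOpen_ball) hcov
  have hsm : ∀ i, ContDiff ℝ 1 (ρ i) := fun i => (ρ i).contMDiff.contDiff.of_le (by simp)
  have hcs : ∀ i, HasCompactSupport (ρ i) := fun i =>
    (isCompact_closedBall ((i : closure Ω) : E) 1).of_isClosed_subset (isClosed_tsupport _)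
      ((hρ i).trans (inter_subset_right.trans Metric.ball_subset_closedBall))
  have hlip : ∀ i, ∃ K, LipschitzWith K (ρ i) := fun i =>
    ((hsm i).lipschitzWith_of_hasCompactSupport (hcs i) (by simp))
  have hsum : ∀ x ∈ Ω, ∑ i, ρ i x = 1 := fun x hx => by
    rw [← finsum_eq_sum_of_fintype]
    exact ρ.sum_eq_one (subset_closure hx)
  have hsumd : ∀ x ∈ Ω, ∑ i, fderiv ℝ (ρ i) x (G x) = 0 := fun x hx => by
    have h1 : HasFDerivAt (fun x => ∑ i, ρ i x) (∑ i, fderiv ℝ (ρ i) x) x :=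
      HasFDerivAt.fun_sum fun i _ => ((hsm i).differentiable (by simp) x).hasFDerivAt
    have h2 : HasFDerivAt (fun x => ∑ i, ρ i x) (0 : E →L[ℝ] ℝ) x := by
      refine (hasFDerivAt_const (1 : ℝ) x).congr_of_eventuallyEq ?_
      filter_upwards [hΩ.mem_nhds hx] with w hw using hsum w hw
    have h3 := h1.unique h2
    simpa using congrArg (fun D : E →L[ℝ] ℝ => D (G x)) h3
  have hint : ∀ i, IntegrableOn (fun x => f x * ρ i x + fderiv ℝ (ρ i) x (G x)) Ω := fun i => by
    obtain ⟨K, hK⟩ := hlip i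
    obtain ⟨A, hA⟩ := hK.continuous.bounded_above_of_compact_support (hcs i)
    exact h.integrable hΩ hΩf hK hA
  have heq : ∫ x in Ω, f x = ∑ i, ∫ x in Ω, (f x * ρ i x + fderiv ℝ (ρ i) x (G x)) := by
    rw [← integral_finsetSum _ fun i _ => hint i]
    refine setIntegral_congr_fun hΩ.measurableSet fun x hx => ?_
    rw [Finset.sum_add_distrib, hsumd x hx, ← Finset.mul_sum, hsum x hx]
    ring
  rw [heq]
  refine Finset.sum_nonpos fun i _ => ?_
  obtain ⟨K, hK⟩ := hlip i
  exact (hV _ i.1.2).2 _ K hK (hcs i) ((hρ i).trans inter_subset_left) (ρ.nonneg i)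

end Divergence

attribute [local instance] Matrix.normedAddCommGroup Matrix.normedSpace

/-! ### Gradient matrices and the Clapeyron identity -/

section Gradient

variable {m n : ℕ}

/-- The matrix of a linear map between Euclidean spaces. -/
noncomputable def toMat (T : E n →L[ℝ] E m) : Mat m n :=
  Matrix.of fun i α => (T (EuclideanSpace.single α 1)) i

theorem grad_eq (y : E n → E m) (x : E n) : grad y x = toMat (fderiv ℝ y x) := rfl

theorem gradWithin_eq (s : Set (E n)) (y : E n → E m) (x : E n) :
    gradWithin s y x = toMat (fderivWithin ℝ y s x) := rfl

theorem continuous_toMat : Continuous (toMat : (E n →L[ℝ] E m) → Mat m n) := by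
  refine continuous_matrix fun i α => ?_
  exact (EuclideanSpace.proj (𝕜 := ℝ) i).continuous.comp
    (ContinuousLinearMap.apply ℝ (E m) (EuclideanSpace.single α (1 : ℝ))).continuous

theorem toMat_add (S T : E n →L[ℝ] E m) : toMat (S + T) = toMat S + toMat T := rfl

theorem toMat_smul (c : ℝ) (T : E n →L[ℝ] E m) : toMat (c • T) = c • toMat T := rfl

theorem clm_apply_eq_sum (T : E n →L[ℝ] E m) (v : E n) (i : Fin m) :
    T v i = ∑ α, toMat T i α * v α := by
  have hv : v = ∑ α, v α • EuclideanSpace.single α (1 : ℝ) := by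
    ext β
    simp [Pi.single_apply]
  conv_lhs => rw [hv]
  simp [toMat, mul_comm]

theorem functional_eq_sum (ℓ : E n →L[ℝ] ℝ) (v : E n) :
    ℓ v = ∑ α, v α * ℓ (EuclideanSpace.single α 1) := by
  have hv : v = ∑ α, v α • EuclideanSpace.single α (1 : ℝ) := by
    ext β
    simp [Pi.single_apply]
  conv_lhs => rw [hv]
  simp

theorem toMat_smulRight (ℓ : E n →L[ℝ] ℝ) (d : E m) :
    toMat (ℓ.smulRight d) = Matrix.of fun i α => d i * ℓ (EuclideanSpace.single α 1) := by
  ext i α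
  simp [toMat, mul_comm]

theorem toMat_id : toMat (ContinuousLinearMap.id ℝ (E n)) = 1 := by
  ext i α
  simp [toMat, PiLp.single_apply, Matrix.one_apply]

theorem frob_add_right (A B C : Mat m n) : frob A (B + C) = frob A B + frob A C := by
  simp [frob, mul_add, Finset.sum_add_distrib]

theorem frob_smul_right (A B : Mat m n) (c : ℝ) : frob A (c • B) = c * frob A B := by
  simp only [frob, Matrix.smul_apply, smul_eq_mul, Finset.mul_sum]
  exact Finset.sum_congr rfl fun _ _ => Finset.sum_congr rfl fun _ _ => by ring

theorem continuous_frob : Continuous fun p : Mat m n × Mat m n => frob p.1 p.2 := by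
  unfold frob
  exact continuous_finsetSum _ fun i _ => continuous_finsetSum _ fun α _ =>
    (continuous_fst.matrix_elem i α).mul (continuous_snd.matrix_elem i α)

theorem frob_piola {W : Mat m n → ℝ} (F B : Mat m n) :
    frob (piola W F) B = fderiv ℝ W F B := by
  conv_rhs => rw [Matrix.matrix_eq_sum_single B]
  simp only [frob, piola, map_sum, Matrix.of_apply]
  refine Finset.sum_congr rfl fun i _ => Finset.sum_congr rfl fun α _ => ?_
  rw [show Matrix.single i α (B i α) = B i α • Matrix.single i α (1 : ℝ) by
    rw [Matrix.smul_single, smul_eq_mul, mul_one], map_smul, smul_eq_mul, mul_comm]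

theorem IsC1Density.continuous_piola {W : Mat m n → ℝ} (hW : IsC1Density W) :
    Continuous (piola W) := by
  refine continuous_matrix fun i α => ?_
  exact (hW.continuous_fderiv one_ne_zero).clm_apply continuous_const

theorem IsC1Density.continuous_eshelby {W : Mat m n → ℝ} (hW : IsC1Density W) :
    Continuous (eshelby W) := by
  have h1 : Continuous W := hW.continuous
  have h2 := hW.continuous_piola
  unfold eshelby
  exact (h1.smul continuous_const).sub (continuous_id.matrix_transpose.matrix_mul h2)

/-- The flux in the Clapeyron identity, at position `d`, relative displacement `u`,
and gradient `T`. -/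
noncomputable def clapeyronFlux (W : Mat m n → ℝ) (d : E n) (u : E m) (T : E n →L[ℝ] E m) : E n :=
  W (toMat T) • d - WithLp.toLp 2 ((piola W (toMat T))ᵀ *ᵥ (T d - u).ofLp)

theorem IsC1Density.continuous_clapeyronFlux {W : Mat m n → ℝ} (hW : IsC1Density W) :
    Continuous fun p : E n × E m × (E n →L[ℝ] E m) => clapeyronFlux W p.1 p.2.1 p.2.2 := by
  have h1 : Continuous W := hW.continuous
  have h2 := hW.continuous_piola
  have h3 : Continuous fun p : E n × E m × (E n →L[ℝ] E m) => toMat p.2.2 :=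
    continuous_toMat.comp (continuous_snd.comp continuous_snd)
  have h4 : Continuous fun p : E n × E m × (E n →L[ℝ] E m) => p.2.2 p.1 - p.2.1 := by fun_prop
  unfold clapeyronFlux
  refine ((h1.comp h3).smul continuous_fst).sub ?_
  refine (PiLp.continuous_toLp 2 _).comp ?_
  exact (h2.comp h3).matrix_transpose.matrix_mulVec ((PiLp.continuous_ofLp 2 _).comp h4)

/-- Here `c` and `ℓ` stand for the value and differential of a cutoff `χ`, so the two left-hand
matrices are the gradients of `χ (x - x₀)` and `χ (y - const)`. The trace of `P*` is `n W - ⟨P, F⟩`,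
and its last term cancels against `⟨P, F⟩` from the Piola part. -/
theorem clapeyron_identity (W : Mat m n → ℝ) (T : E n →L[ℝ] E m) (c : ℝ) (ℓ : E n →L[ℝ] ℝ)
    (d : E n) (u : E m) :
    frob (eshelby W (toMat T)) (toMat (c • ContinuousLinearMap.id ℝ (E n) + ℓ.smulRight d)) +
      frob (piola W (toMat T)) (toMat (c • T + ℓ.smulRight u)) =
    n * W (toMat T) * c + ℓ (clapeyronFlux W d u T) := by
  rw [toMat_add, toMat_add, toMat_smul, toMat_smul, toMat_id, toMat_smulRight, toMat_smulRight,
    frob_add_right, frob_add_right, frob_smul_right, frob_smul_right,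
    functional_eq_sum ℓ (clapeyronFlux W d u T)]
  set F := toMat T with hF
  set P := piola W F with hP
  have h1 : frob (eshelby W F) 1 = n * W F - frob P F := by
    have : frob (eshelby W F) 1 = Matrix.trace (eshelby W F) := by
      simp [frob, Matrix.trace, Matrix.one_apply]
    rw [this, eshelby, Matrix.trace_sub, Matrix.trace_smul, Matrix.trace_one, ← hP]
    simp only [Matrix.trace, frob, Matrix.diag, Matrix.mul_apply, Matrix.transpose_apply,
      Fintype.card_fin, smul_eq_mul]
    rw [Finset.sum_comm]
    simp_rw [mul_comm (F _ _)]
    ring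
  have h2 : ∀ α, (clapeyronFlux W d u T) α =
      W F * d α - ∑ k, P k α * (∑ i, F k i * d i - u k) := by
    intro α
    simp only [clapeyronFlux, ← hF, ← hP, PiLp.sub_apply, PiLp.smul_apply, smul_eq_mul,
      Matrix.mulVec, dotProduct, Matrix.transpose_apply, clm_apply_eq_sum, WithLp.ofLp_sub,
      Pi.sub_apply]
  have h3 : frob (eshelby W F) (Matrix.of fun i α => d i * ℓ (EuclideanSpace.single α 1)) =
      ∑ α, (W F * d α - ∑ k, P k α * ∑ i, F k i * d i) * ℓ (EuclideanSpace.single α 1) := by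
    simp only [frob, eshelby, ← hP, Matrix.sub_apply, Matrix.smul_apply, smul_eq_mul,
      Matrix.mul_apply, Matrix.transpose_apply, Matrix.of_apply, Matrix.one_apply]
    rw [Finset.sum_comm]
    refine Finset.sum_congr rfl fun α _ => ?_
    simp only [sub_mul, Finset.sum_sub_distrib]
    congr 1
    · simp [mul_assoc]
    · simp only [Finset.sum_mul, Finset.mul_sum]
      rw [Finset.sum_comm]
      exact Finset.sum_congr rfl fun _ _ => Finset.sum_congr rfl fun _ _ => by ring
  have h4 : frob P (Matrix.of fun i α => u i * ℓ (EuclideanSpace.single α 1)) =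
      ∑ α, (∑ k, P k α * u k) * ℓ (EuclideanSpace.single α 1) := by
    simp only [frob, Matrix.of_apply]
    rw [Finset.sum_comm]
    refine Finset.sum_congr rfl fun α _ => ?_
    rw [Finset.sum_mul]
    exact Finset.sum_congr rfl fun _ _ => by ring
  have h5 : ∑ α, (clapeyronFlux W d u T) α * ℓ (EuclideanSpace.single α 1) =
      frob (eshelby W F) (Matrix.of fun i α => d i * ℓ (EuclideanSpace.single α 1)) +
      frob P (Matrix.of fun i α => u i * ℓ (EuclideanSpace.single α 1)) := by
    rw [h3, h4, ← Finset.sum_add_distrib]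
    refine Finset.sum_congr rfl fun α _ => ?_
    rw [h2]
    simp only [mul_sub, Finset.sum_sub_distrib]
    ring
  rw [h1, h5]
  ring

theorem LipschitzWith.fderiv_mem_closedBall {y : E n → E m} {K : ℝ≥0} (hy : LipschitzWith K y)
    (x : E n) : fderiv ℝ y x ∈ Metric.closedBall (0 : E n →L[ℝ] E m) K := by
  simpa using norm_fderiv_le_of_lipschitz ℝ hy

/-- Needed because the Clapeyron identity tests with multiples of the displacement `y`, which is
merely Lipschitz. -/
theorem DivFree.lipschitz_test {k : ℕ} {Ω : Set (E n)} (hΩ : IsOpen Ω) (hΩf : volume Ω ≠ ⊤)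
    {y : E n → E m} {K : ℝ≥0} (hy : LipschitzWith K y) {Q : Mat m n → Mat k n}
    (hQ : Continuous Q) (hdiv : DivFree Ω fun x => Q (grad y x)) {φ : E n → E k} {K' : ℝ≥0}
    (hφ : LipschitzWith K' φ) (hc : HasCompactSupport φ) (hs : tsupport φ ⊆ Ω) :
    IntegrableOn (fun x => frob (Q (grad y x)) (grad φ x)) Ω ∧
      ∫ x in Ω, frob (Q (grad y x)) (grad φ x) = 0 := by
  have hcont : Continuous fun p : (E n →L[ℝ] E m) × (E n →L[ℝ] E k) =>
      frob (Q (toMat p.1)) (toMat p.2) :=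
    continuous_frob.comp (((hQ.comp continuous_toMat).comp continuous_fst).prodMk
      (continuous_toMat.comp continuous_snd))
  refine integral_fderiv_eq_zero_of_smooth (L := fun x T => frob (Q (grad y x)) (toMat T)) hΩ hΩf
    ?_ ?_ ?_ hdiv hφ hc hs
  · intro Φ hΦ
    exact (hcont.comp_stronglyMeasurable
      ((stronglyMeasurable_fderiv y).prodMk hΦ)).aestronglyMeasurable
  · intro x _
    exact hcont.comp (f := fun T => (fderiv ℝ y x, T)) (by fun_prop)
  · intro R
    obtain ⟨C, hC⟩ := ((isCompact_closedBall_clm (0 : E n →L[ℝ] E m) K).prod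
      (isCompact_closedBall_clm (0 : E n →L[ℝ] E k) R)).exists_bound_of_continuousOn hcont.continuousOn
    exact ⟨C, fun x _ T hT => hC (fderiv ℝ y x, T)
      (mk_mem_prod (LipschitzWith.fderiv_mem_closedBall hy x) (by simpa using hT))⟩

/-- The Clapeyron identity in weak form. -/
theorem exists_hasWeakDiv_clapeyronFlux {W : Mat m n → ℝ} (hW : IsC1Density W) {Ω : Set (E n)}
    (hΩ : IsOpen Ω) (hΩb : Bornology.IsBounded Ω) {y : E n → E m} {K : ℝ≥0}
    (hy : LipschitzWith K y) (hEL : DivFree Ω fun x => piola W (grad y x))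
    (hN : DivFree Ω fun x => eshelby W (grad y x)) (x₀ : E n) (c : E m) :
    ∃ C, HasWeakDiv Ω (fun x => clapeyronFlux W (x - x₀) (y x - c) (fderiv ℝ y x))
      (fun x => n * W (grad y x)) C := by
  have hΩf : volume Ω ≠ ⊤ := hΩb.measure_lt_top.ne
  have hWc : Continuous fun T : E n →L[ℝ] E m => (n : ℝ) * W (toMat T) :=
    continuous_const.mul (hW.continuous.comp continuous_toMat)
  have hK : IsCompact (Metric.closedBall (0 : E n →L[ℝ] E m) K) := isCompact_closedBall_clm _ _
  have hcl : IsCompact (closure Ω) := hΩb.isCompact_closure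
  obtain ⟨C₁, hC₁⟩ := hK.exists_bound_of_continuousOn hWc.continuousOn
  have hflux : Continuous fun p : E n × (E n →L[ℝ] E m) =>
      clapeyronFlux W (p.1 - x₀) (y p.1 - c) p.2 := by
    have := hy.continuous
    exact hW.continuous_clapeyronFlux.comp
      (f := fun p : E n × (E n →L[ℝ] E m) => (p.1 - x₀, y p.1 - c, p.2)) (by fun_prop)
  obtain ⟨C₂, hC₂⟩ := (hcl.prod hK).exists_bound_of_continuousOn hflux.continuousOn
  refine ⟨max 0 (max C₁ C₂), le_max_left _ _, ?_, ?_, ?_, ?_, ?_⟩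
  · exact measurable_comp_fderiv hflux y
  · exact measurable_comp_fderiv (hWc.comp continuous_snd) y
  · intro x hx
    exact (hC₂ (x, fderiv ℝ y x) (mk_mem_prod (subset_closure hx)
      (LipschitzWith.fderiv_mem_closedBall hy x))).trans
      ((le_max_right _ _).trans (le_max_right _ _))
  · intro x _
    exact (hC₁ _ (LipschitzWith.fderiv_mem_closedBall hy x)).trans
      ((le_max_left _ _).trans (le_max_right _ _))
  · intro χ Kχ hχ hχc hχs
    -- The Noether equation is tested with `χ (x - x₀)` and the Euler–Lagrange equation with `χ (y -
    -- c)`.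
    obtain ⟨K₁, hL₁⟩ := exists_lipschitzWith_smul hχ hχc
      ((LipschitzWith.id (α := E n)).sub (LipschitzWith.const x₀))
    obtain ⟨K₂, hL₂⟩ := exists_lipschitzWith_smul hχ hχc (hy.sub (LipschitzWith.const c))
    have hsup : ∀ {k : ℕ} (v : E n → E k), tsupport (fun x => χ x • v x) ⊆ tsupport χ :=
      fun v => closure_mono (Function.support_smul_subset_left χ v)
    have hcs : ∀ {k : ℕ} (v : E n → E k), HasCompactSupport (fun x => χ x • v x) :=
      fun v => hχc.smul_right
    obtain ⟨hi₁, hz₁⟩ := DivFree.lipschitz_test hΩ hΩf hy hW.continuous_eshelby hN hL₁ (hcs _)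
      ((hsup _).trans hχs)
    obtain ⟨hi₂, hz₂⟩ := DivFree.lipschitz_test hΩ hΩf hy hW.continuous_piola hEL hL₂ (hcs _)
      ((hsup _).trans hχs)
    have hz := integral_add hi₁ hi₂
    rw [hz₁, hz₂, add_zero] at hz
    rw [← hz]
    refine integral_congr_ae ?_
    filter_upwards [ae_restrict_of_ae (hχ.ae_differentiableAt (μ := volume)),
      ae_restrict_of_ae (hy.ae_differentiableAt (μ := volume))] with x h1 h2
    have e1 : HasFDerivAt (fun x => χ x • (x - x₀)) (χ x • ContinuousLinearMap.id ℝ (E n) +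
        (fderiv ℝ χ x).smulRight (x - x₀)) x :=
      h1.hasFDerivAt.smul ((hasFDerivAt_id x).sub_const x₀)
    have e2 : HasFDerivAt (fun x => χ x • (y x - c)) (χ x • fderiv ℝ y x +
        (fderiv ℝ χ x).smulRight (y x - c)) x :=
      h1.hasFDerivAt.smul (h2.hasFDerivAt.sub_const c)
    have e3 : grad (fun x => χ x • (id x - x₀)) x = toMat (χ x • ContinuousLinearMap.id ℝ (E n) +
        (fderiv ℝ χ x).smulRight (x - x₀)) := by
      rw [← e1.fderiv]; rfl
    have e4 : grad (fun x => χ x • (y x - c)) x = toMat (χ x • fderiv ℝ y x +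
        (fderiv ℝ χ x).smulRight (y x - c)) := by
      rw [← e2.fderiv]; rfl
    rw [grad_eq y]
    exact (e3 ▸ e4 ▸ clapeyron_identity W (fderiv ℝ y x) (χ x) (fderiv ℝ χ x) (x - x₀)
      (y x - c)).symm

end Gradient

/-! ### Envelopes and the sign of the boundary flux -/

section Pointwise

variable {m n : ℕ}

theorem le_RW {W V : Mat m n → ℝ} (hV : IsRankOneConvex V) (hVW : ∀ G, V G ≤ W G) (F : Mat m n) :
    (V F : EReal) ≤ RW W F :=
  le_iSup₂ (f := fun (V : Mat m n → ℝ)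
    (_ : V ∈ {V : Mat m n → ℝ | IsRankOneConvex V ∧ ∀ G, V G ≤ W G}) => (V F : EReal)) V ⟨hV, hVW⟩

theorem le_QW {W V : Mat m n → ℝ} (hV : IsQuasiconvex V) (hVW : ∀ G, V G ≤ W G) (F : Mat m n) :
    (V F : EReal) ≤ QW W F :=
  le_iSup₂ (f := fun (V : Mat m n → ℝ)
    (_ : V ∈ {V : Mat m n → ℝ | IsQuasiconvex V ∧ ∀ G, V G ≤ W G}) => (V F : EReal)) V ⟨hV, hVW⟩

theorem QW_le (W : Mat m n → ℝ) (F : Mat m n) : QW W F ≤ W F :=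
  iSup₂_le fun _ hV => EReal.coe_le_coe_iff.2 (hV.2 F)

theorem exists_lt_of_lt_RW {W : Mat m n → ℝ} {F : Mat m n} {c : ℝ} (h : (c : EReal) < RW W F) :
    ∃ V : Mat m n → ℝ, IsRankOneConvex V ∧ (∀ G, V G ≤ W G) ∧ c < V F := by
  simp only [RW, lt_iSup_iff] at h
  obtain ⟨V, hV, hc⟩ := h
  exact ⟨V, hV.1, hV.2, EReal.coe_lt_coe_iff.1 hc⟩

theorem exists_lt_of_lt_QW {W : Mat m n → ℝ} {F : Mat m n} {c : ℝ} (h : (c : EReal) < QW W F) :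
    ∃ V : Mat m n → ℝ, IsQuasiconvex V ∧ (∀ G, V G ≤ W G) ∧ c < V F := by
  simp only [QW, lt_iSup_iff] at h
  obtain ⟨V, hV, hc⟩ := h
  exact ⟨V, hV.1, hV.2, EReal.coe_lt_coe_iff.1 hc⟩

/-- At a point where `W` agrees with its rank-one convex envelope, the tangent at that point bounds
the envelope from below in rank-one directions. -/
theorem sub_fderiv_le_of_eq_RW {W : Mat m n → ℝ} (hW : IsC1Density W) {F F₀ : Mat m n}
    {a : Fin m → ℝ} {b : Fin n → ℝ} (hF : F - F₀ = Matrix.vecMulVec a b)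
    (hRW : (W F : EReal) = RW W F) {r : ℝ} (hr : RW W F₀ ≤ r) :
    W F - fderiv ℝ W F (F - F₀) ≤ r := by
  -- `F` is the convex combination of `F₀` (parameter `-1`) and `F + t (F - F₀)` with weights
  -- `t/(1+t)` and `1/(1+t)`. The supremum defining `RW` need not be attained, so a competitor
  -- within `δ` at `F` is used. Dividing by `t` and letting `t → 0⁺` gives the claim.
  have key : ∀ t : ℝ, 0 < t → (1 + t) * W F ≤ t * r + W (F + t • (F - F₀)) := by
    intro t ht
    have h1 : ∀ δ : ℝ, 0 < δ → (1 + t) * (W F - δ) ≤ t * r + W (F + t • (F - F₀)) := by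
      intro δ hδ
      obtain ⟨V, hV, hVW, hlt⟩ := exists_lt_of_lt_RW (W := W) (F := F) (c := W F - δ)
        (by rw [← hRW]; exact EReal.coe_lt_coe_iff.2 (by linarith))
      have hV0 : V F₀ ≤ r := EReal.coe_le_coe_iff.1 ((le_RW hV hVW F₀).trans hr)
      have ht1 : 0 < 1 + t := by linarith
      have hcv := (hV F a b).2
      have hc := hcv (mem_univ (-1)) (mem_univ t) (show 0 ≤ t / (1 + t) by positivity)
        (show 0 ≤ 1 / (1 + t) by positivity) (by field_simp; ring)
      have e0 : t / (1 + t) * (-1 : ℝ) + (1 / (1 + t)) * t = 0 := by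
        field_simp; ring
      simp only [smul_eq_mul, e0, ← hF, zero_smul, add_zero] at hc
      rw [show F + (-1 : ℝ) • (F - F₀) = F₀ by module] at hc
      have hc2 : (1 + t) * V F ≤ t * V F₀ + V (F + t • (F - F₀)) := by
        calc (1 + t) * V F ≤ (1 + t) * (t / (1 + t) * V F₀ +
              1 / (1 + t) * V (F + t • (F - F₀))) := mul_le_mul_of_nonneg_left hc ht1.le
          _ = _ := by field_simp
      have h2 := mul_le_mul_of_nonneg_left hV0 ht.le
      have h3 := hVW (F + t • (F - F₀))
      have h4 := mul_le_mul_of_nonneg_left hlt.le ht1.le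
      linarith
    refine le_of_forall_pos_le_add fun η hη => ?_
    have := h1 (η / (1 + t)) (by positivity)
    have e : (1 + t) * (η / (1 + t)) = η := by field_simp
    linarith
  have hd : HasDerivAt (fun t : ℝ => W (F + t • (F - F₀))) (fderiv ℝ W F (F - F₀)) 0 := by
    have h1 : HasDerivAt (fun t : ℝ => F + t • (F - F₀)) (F - F₀) 0 := by
      have := ((hasDerivAt_id (0 : ℝ)).smul_const (F - F₀)).const_add F
      rwa [one_smul] at this
    have h2 : HasFDerivAt W (fderiv ℝ W F) (F + (0 : ℝ) • (F - F₀)) := by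
      rw [zero_smul, add_zero]
      exact (hW.differentiable one_ne_zero F).hasFDerivAt
    exact h2.comp_hasDerivAt (0 : ℝ) h1
  have hlim := hd.tendsto_slope_zero_right
  have : W F - r ≤ fderiv ℝ W F (F - F₀) := by
    refine ge_of_tendsto hlim ?_
    filter_upwards [self_mem_nhdsWithin] with t ht
    have ht' : 0 < t := ht
    simp only [zero_add, zero_smul, add_zero, smul_eq_mul]
    rw [inv_mul_eq_div, le_div_iff₀ ht']
    linarith [key t ht']
  linarith

/-- The map `x ↦ F x` as a continuous linear map. -/
noncomputable def affineCLM (F : Mat m n) : E n →L[ℝ] E m :=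
  LinearMap.toContinuousLinearMap
    { toFun := affineMap F
      map_add' := fun x y => by ext i; simp [affineMap, Matrix.mulVec_add]
      map_smul' := fun c x => by ext i; simp [affineMap, Matrix.mulVec_smul] }

theorem affineCLM_apply (F : Mat m n) (x : E n) : affineCLM F x = affineMap F x := rfl

theorem toMat_affineCLM (F : Mat m n) : toMat (affineCLM F) = F := by
  ext i α
  simp [toMat, affineCLM_apply, affineMap]

theorem functional_clapeyronFlux (W : Mat m n → ℝ) (ℓ : E n →L[ℝ] ℝ) (d : E n) (u : E m)
    (T : E n →L[ℝ] E m) :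
    ℓ (clapeyronFlux W d u T) =
      W (toMat T) * ℓ d - frob (piola W (toMat T)) (toMat (ℓ.smulRight (T d - u))) := by
  rw [clapeyronFlux, map_sub, map_smul, smul_eq_mul]
  congr 1
  rw [functional_eq_sum ℓ, toMat_smulRight]
  simp only [Matrix.mulVec, dotProduct, Matrix.transpose_apply, frob, Matrix.of_apply,
    Finset.sum_mul]
  rw [Finset.sum_comm]
  exact Finset.sum_congr rfl fun _ _ => Finset.sum_congr rfl fun _ _ => by ring

/-- The Clapeyron flux points inwards where the boundary gradient is a rank-one perturbation `F`
of `F₀` such that the tangent of `W` at `F` is non-positive at `F₀`. -/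
theorem functional_clapeyronFlux_nonneg {W : Mat m n → ℝ} {F₀ : Mat m n}
    {T : E n →L[ℝ] E m}
    (hW : ∀ (a : Fin m → ℝ) (b : Fin n → ℝ), toMat T - F₀ = Matrix.vecMulVec a b →
      W (toMat T) - fderiv ℝ W (toMat T) (toMat T - F₀) ≤ 0)
    {ℓ : E n →L[ℝ] ℝ} {ν : E n}
    (hT : ∀ v, T (v + ℓ v • ν) = affineCLM F₀ (v + ℓ v • ν)) {d : E n} (hd : ℓ d ≤ 0) :
    0 ≤ ℓ (clapeyronFlux W d (affineMap F₀ d) T) := by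
  -- `T - F₀` annihilates every tangential vector `v + ℓ v • ν`, which forces `T - F₀ = ℓ ⊗ a` with
  -- this `a`.
  set a : E m := -(T - affineCLM F₀) ν with ha
  have hv : ∀ v, (T - affineCLM F₀) v = ℓ v • a := fun v => by
    have := hT v
    simp only [map_add, map_smul] at this
    simp only [ha, sub_apply, smul_neg, smul_sub]
    rw [sub_eq_iff_eq_add]
    have h2 : T v = affineCLM F₀ v + ℓ v • affineCLM F₀ ν - ℓ v • T ν := by
      rw [← this]; abel
    rw [h2]; abel
  have hS : T - affineCLM F₀ = ℓ.smulRight a := by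
    ext1 v; rw [hv]; rfl
  have hF : toMat T - F₀ = toMat (ℓ.smulRight a) := by
    rw [← hS]
    conv_lhs => rw [← toMat_affineCLM F₀]
    rfl
  have hF' : toMat T - F₀ =
      Matrix.vecMulVec a.ofLp fun α => ℓ (EuclideanSpace.single α 1) := by
    rw [hF, toMat_smulRight]; rfl
  have key := hW _ _ hF'
  rw [functional_clapeyronFlux]
  have h1 : T d - affineMap F₀ d = ℓ d • a := hv d
  have h2 : ℓ.smulRight (ℓ d • a) = ℓ d • ℓ.smulRight a := by
    ext1 v; simp [smul_smul, mul_comm]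
  rw [h1, h2, toMat_smul, frob_smul_right, ← hF, frob_piola]
  -- The flux is `ℓ d` times `W - ⟨P, F - F₀⟩`, a product of two non-positive numbers.
  nlinarith

end Pointwise

/-! ### Geometry of Lipschitz charts -/

section Geometry

variable {E : Type*} [NormedAddCommGroup E] [InnerProductSpace ℝ E] {Ω U : Set E} {ν : E}
  {γ : E → ℝ}

theorem mem_frontier_of_chartHeight_eq_zero (hU : IsOpen U) (hν : ‖ν‖ = 1)
    (hΩ : ∀ x ∈ U, (x ∈ Ω ↔ 0 < chartHeight ν γ x)) {x : E} (hx : x ∈ U)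
    (h0 : chartHeight ν γ x = 0) : x ∈ frontier Ω := by
  have hnot : x ∉ Ω := fun h => absurd ((hΩ x hx).1 h) (by rw [h0]; exact lt_irrefl _)
  refine ⟨?_, fun h => hnot (interior_subset h)⟩
  have hc : Tendsto (fun t : ℝ => x + (-t) • ν) (𝓝[>] 0) (𝓝 x) := by
    have : Continuous fun t : ℝ => x + (-t) • ν := by fun_prop
    simpa using (this.tendsto 0).mono_left nhdsWithin_le_nhds
  refine mem_closure_of_tendsto hc ?_
  filter_upwards [hc.eventually (hU.mem_nhds hx), self_mem_nhdsWithin] with t ht ht0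
  rw [hΩ _ ht, chartHeight_add_smul hν, h0]
  simpa using ht0

theorem chartHeight_nonneg_of_mem_closure (hU : IsOpen U) (hγ : Continuous (chartHeight ν γ))
    (hΩ : ∀ x ∈ U, (x ∈ Ω ↔ 0 < chartHeight ν γ x)) {x : E} (hx : x ∈ U) (hc : x ∈ closure Ω) :
    0 ≤ chartHeight ν γ x := by
  by_contra hlt
  obtain ⟨w, ⟨hwU, hw⟩, hwΩ⟩ := mem_closure_iff.1 hc _
    (hU.inter (isOpen_lt hγ continuous_const)) ⟨hx, not_le.1 hlt⟩
  exact absurd ((hΩ w hwU).1 hwΩ) (not_lt.2 (le_of_lt hw))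

/-- An interior cone: all directions close to `-ν` increase the height and so enter `Ω`; they
contain a ball, which spans. This makes the one-sided derivative at the boundary well determined. -/
theorem uniqueDiffWithinAt_of_chart (hU : IsOpen U) (hν : ‖ν‖ = 1) {K : ℝ≥0}
    (hγ : LipschitzWith K (chartHeight ν γ))
    (hΩ : ∀ x ∈ U, (x ∈ Ω ↔ 0 < chartHeight ν γ x)) {q : E} (hq : q ∈ U)
    (h0 : chartHeight ν γ q = 0) : UniqueDiffWithinAt ℝ Ω q := by
  refine ⟨?_, (mem_frontier_of_chartHeight_eq_zero hU hν hΩ hq h0).1⟩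
  obtain ⟨δ, hδ, hball⟩ := Metric.isOpen_iff.1 hU q hq
  -- Moving along `-(δ/2) ν` raises the height at rate `δ/2`. Perturbing the direction by less than
  -- `δ/2/(K+1)` costs less than that, and keeps the direction shorter than `δ`, so the segment
  -- stays in `U`.
  have hsub : Metric.ball (-((δ / 2) • ν)) (δ / 2 / (K + 1)) ⊆ tangentConeAt ℝ Ω q := by
    intro u hu
    have hu' : ‖u + (δ / 2) • ν‖ < δ / 2 / (K + 1) := by
      simpa [dist_eq_norm] using hu
    have hK1 : (0 : ℝ) < K + 1 := by positivity
    have hle : δ / 2 / (K + 1) ≤ δ / 2 :=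
      div_le_self (by positivity) (by linarith [K.coe_nonneg])
    have hun : ‖u‖ < δ := by
      have : u = (u + (δ / 2) • ν) - (δ / 2) • ν := by abel
      rw [this]
      refine (norm_sub_le _ _).trans_lt ?_
      rw [norm_smul, hν, Real.norm_of_nonneg (by positivity)]
      linarith
    have : u = (q + u) - q := by abel
    rw [this]
    refine mem_tangentConeAt_of_openSegment_subset ?_
    rw [openSegment_eq_image']
    rintro _ ⟨t, ⟨ht0, ht1⟩, rfl⟩
    simp only [add_sub_cancel_left]
    have hxU : q + t • u ∈ U := hball (by
      rw [Metric.mem_ball, dist_eq_norm, add_sub_cancel_left, norm_smul,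
        Real.norm_of_nonneg ht0.le]
      exact (mul_le_of_le_one_left (norm_nonneg _) ht1.le).trans_lt hun)
    rw [hΩ _ hxU]
    have h1 := hγ.dist_le_mul (q + (-(t * (δ / 2))) • ν) (q + t • u)
    rw [chartHeight_add_smul hν, h0, Real.dist_eq, dist_eq_norm] at h1
    have h2 : q + (-(t * (δ / 2))) • ν - (q + t • u) = -(t • (u + (δ / 2) • ν)) := by module
    rw [h2, norm_neg, norm_smul, Real.norm_of_nonneg ht0.le] at h1
    have h3 := (le_abs_self _).trans h1
    rw [lt_div_iff₀ hK1] at hu'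
    have h4 : K * ‖u + (δ / 2) • ν‖ < δ / 2 := by
      rcases eq_or_ne ‖u + (δ / 2) • ν‖ 0 with h | h
      · rw [h]; simpa using hδ
      · have : 0 < ‖u + (δ / 2) • ν‖ := lt_of_le_of_ne (norm_nonneg _) h.symm
        nlinarith
    have h5 := mul_lt_mul_of_pos_left h4 ht0
    linarith
  have hspan : Submodule.span ℝ (tangentConeAt ℝ Ω q) = ⊤ := by
    refine Submodule.eq_top_of_nonempty_interior' _ ⟨-((δ / 2) • ν), ?_⟩
    exact interior_mono (hsub.trans Submodule.subset_span)
      (by rw [Metric.isOpen_ball.interior_eq]; exact Metric.mem_ball_self (by positivity))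
  rw [hspan]
  exact dense_univ

/-- Differentiation of boundary values along the boundary. -/
theorem fderivWithin_tangential {F : Type*} [NormedAddCommGroup F] [NormedSpace ℝ F]
    (hU : IsOpen U) (hν : ‖ν‖ = 1)
    (hΩ : ∀ x ∈ U, (x ∈ Ω ↔ 0 < chartHeight ν γ x)) {q : E} (hq : q ∈ U)
    (h0 : chartHeight ν γ q = 0) {D : E →L[ℝ] ℝ} (hD : HasFDerivAt (chartHeight ν γ) D q)
    (hγ : Continuous (chartHeight ν γ))
    {y : E → F} {T T₀ : E →L[ℝ] F} (hy : HasFDerivWithinAt y T (closure Ω) q)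
    (hbc : ∀ x ∈ frontier Ω, y x = T₀ x) (v : E) : T (v + D v • ν) = T₀ (v + D v • ν) := by
  -- The line `q + t v` is pushed along `ν` back onto the graph; its velocity at `0` is `v + D v •
  -- ν`.
  let c : ℝ → E := fun t => q + t • v + chartHeight ν γ (q + t • v) • ν
  have hc0 : c 0 = q := by simp [c, h0]
  have hl : HasDerivAt (fun t : ℝ => q + t • v) v 0 := by
    simpa using ((hasDerivAt_id (0 : ℝ)).smul_const v).const_add q
  have hD' : HasFDerivAt (chartHeight ν γ) D (q + (0 : ℝ) • v) := by simpa using hD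
  have hcd : HasDerivAt c (v + D v • ν) 0 :=
    hl.add ((hD'.comp_hasDerivAt (0 : ℝ) hl).smul_const ν)
  have hcc : Continuous c := by
    have : Continuous fun t : ℝ => q + t • v := by fun_prop
    exact this.add ((hγ.comp this).smul continuous_const)
  have hev : ∀ᶠ t in 𝓝 (0 : ℝ), c t ∈ frontier Ω := by
    have : ∀ᶠ t in 𝓝 (0 : ℝ), c t ∈ U := by
      refine hcc.continuousAt.eventually (hU.mem_nhds ?_)
      rwa [hc0]
    filter_upwards [this] with t ht
    refine mem_frontier_of_chartHeight_eq_zero hU hν hΩ ht ?_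
    rw [chartHeight_add_smul hν, sub_self]
  have hy' : HasFDerivWithinAt y T (closure Ω) (c 0) := by rwa [hc0]
  have h1 : HasDerivAt (y ∘ c) (T (v + D v • ν)) 0 := by
    have := hy'.comp_hasDerivWithinAt (0 : ℝ) (s := {t | c t ∈ closure Ω}) hcd.hasDerivWithinAt
      fun t ht => ht
    exact this.hasDerivAt (hev.mono fun t ht => ht.1)
  have h2 : HasDerivAt (T₀ ∘ c) (T₀ (v + D v • ν)) 0 :=
    T₀.hasFDerivAt.comp_hasDerivAt (0 : ℝ) hcd
  exact h1.unique (h2.congr_of_eventuallyEq (hev.mono fun t ht => hbc _ ht))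

/-- On the boundary of a star-shaped domain the position vector points outwards. -/
theorem fderiv_chartHeight_sub_center_nonpos (hU : IsOpen U) (hγ : Continuous (chartHeight ν γ))
    (hΩ : ∀ x ∈ U, (x ∈ Ω ↔ 0 < chartHeight ν γ x)) {q : E} (hq : q ∈ U) (hqc : q ∈ closure Ω)
    (h0 : chartHeight ν γ q = 0) {D : E →L[ℝ] ℝ} (hD : HasFDerivAt (chartHeight ν γ) D q)
    {x₀ : E} (hs : StarConvex ℝ x₀ Ω) : D (q - x₀) ≤ 0 := by
  have hl : HasDerivAt (fun t : ℝ => q + t • (x₀ - q)) (x₀ - q) 0 := by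
    simpa using ((hasDerivAt_id (0 : ℝ)).smul_const (x₀ - q)).const_add q
  have hD' : HasFDerivAt (chartHeight ν γ) D (q + (0 : ℝ) • (x₀ - q)) := by simpa using hD
  have hlim := (hD'.comp_hasDerivAt (0 : ℝ) hl).tendsto_slope_zero_right
  have hc : Continuous fun t : ℝ => q + t • (x₀ - q) := by fun_prop
  have hev : ∀ᶠ t in 𝓝 (0 : ℝ), q + t • (x₀ - q) ∈ U :=
    hc.continuousAt.eventually (hU.mem_nhds (by simpa using hq))
  -- The height vanishes at `q` and is non-negative on the initial segment towards `x₀`, which stays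
  -- in `closure Ω`.
  have h1 : 0 ≤ D (x₀ - q) := by
    refine ge_of_tendsto hlim ?_
    filter_upwards [self_mem_nhdsWithin, nhdsWithin_le_nhds hev,
      nhdsWithin_le_nhds (Iio_mem_nhds (zero_lt_one' ℝ))] with t ht htU ht1
    have ht' : 0 < t := ht
    have ht1' : t < 1 := ht1
    have hmem : q + t • (x₀ - q) ∈ closure Ω := by
      have hcont : Continuous fun x : E => t • x₀ + (1 - t) • x := by fun_prop
      have := map_mem_closure hcont hqc (t := Ω) fun x hx =>
        hs hx ht'.le (by linarith) (by ring)
      convert this using 1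
      module
    have := chartHeight_nonneg_of_mem_closure hU hγ hΩ htU hmem
    simp only [Function.comp, zero_add, zero_smul, add_zero, h0, sub_zero, smul_eq_mul]
    positivity
  have h2 : x₀ - q = -(q - x₀) := by abel
  rw [h2, map_neg] at h1
  linarith

variable [FiniteDimensional ℝ E] [MeasurableSpace E] [BorelSpace E]

/-- A property that holds almost everywhere for the surface measure holds at almost all points of
a graph. -/
theorem ae_graph_of_ae_hausdorffMeasure (hν : ‖ν‖ = 1) {P : E → Prop}
    (h : ∀ᵐ x ∂(Measure.hausdorffMeasure ((Module.finrank ℝ E : ℝ) - 1) : Measure E), P x) :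
    ∀ᵐ z : (ℝ ∙ ν)ᗮ, P ((z : E) + γ z • ν) := by
  have hfin : ((Module.finrank ℝ E : ℝ) - 1) = Module.finrank ℝ (ℝ ∙ ν)ᗮ := by
    have h1 := (ℝ ∙ ν).finrank_add_finrank_orthogonal
    rw [finrank_span_singleton (by rintro rfl; simp at hν)] at h1
    rw [← h1]; push_cast; ring
  rw [hfin] at h
  -- The projection is Lipschitz, so it sends Hausdorff-null sets to null sets of the hyperplane,
  -- and it inverts the graph map.
  let π : E →L[ℝ] (ℝ ∙ ν)ᗮ := (ℝ ∙ ν)ᗮ.orthogonalProjectionOnto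
  have hπν : π ν = 0 := by
    simp [π]
  have hπ : ∀ z : (ℝ ∙ ν)ᗮ, π ((z : E) + γ z • ν) = z := fun z => by
    rw [map_add, map_smul, hπν]; simp [π]
  have h2 := π.lipschitz.hausdorffMeasure_image_le (d := (Module.finrank ℝ (ℝ ∙ ν)ᗮ : ℝ))
    (by positivity) {x | ¬ P x}
  rw [ae_iff.1 h, mul_zero] at h2
  have h3 : (volume : Measure (ℝ ∙ ν)ᗮ) (π '' {x | ¬ P x}) = 0 :=
    Measure.absolutelyContinuous_isAddHaarMeasure volume
      (Measure.hausdorffMeasure (Module.finrank ℝ (ℝ ∙ ν)ᗮ : ℝ)) (nonpos_iff_eq_zero.1 h2)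
  refine measure_mono_null (fun z hz => ?_) h3
  exact ⟨_, hz, hπ z⟩

end Geometry

theorem IsC1Density.continuous {m n : ℕ} {W : Mat m n → ℝ} (hW : IsC1Density W) :
    Continuous W :=
  ContDiff.continuous hW

/-! ### Shifting the density by a constant -/

section Shift

variable {m n : ℕ}

/-- Integration by parts against the constant `1`. -/
theorem integral_fderiv_eq_zero_of_hasCompactSupport {g : E n → ℝ} (hg : ContDiff ℝ 1 g)
    (hc : HasCompactSupport g) (v : E n) : ∫ x, fderiv ℝ g x v = 0 := by
  obtain ⟨K, hK⟩ := hg.lipschitzWith_of_hasCompactSupport hc one_ne_zero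
  have h := LipschitzWith.integral_lineDeriv_mul_eq (μ := (volume : Measure (E n)))
    (LipschitzWith.const (1 : ℝ)) hK hc (-v)
  have h1 : ∀ x, lineDeriv ℝ (fun _ : E n => (1 : ℝ)) x (-v) = 0 := fun x => by
    simp [lineDeriv]
  simp only [h1, zero_mul, integral_zero, neg_neg, mul_one] at h
  rw [h]
  refine integral_congr_ae (Eventually.of_forall fun x => ?_)
  exact (((hg.differentiable one_ne_zero) x).lineDeriv_eq_fderiv (v := v)).symm

theorem divFree_one {Ω : Set (E n)} (r : ℝ) : ∀ φ : E n → E n, ContDiff ℝ ∞ φ →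
    HasCompactSupport φ → tsupport φ ⊆ Ω →
    IntegrableOn (fun x => frob (r • (1 : Mat n n)) (grad φ x)) Ω ∧
      ∫ x in Ω, frob (r • (1 : Mat n n)) (grad φ x) = 0 := by
  intro φ hφ hc hs
  have hφi : ∀ i, ContDiff ℝ 1 fun x => φ x i := fun i =>
    ((EuclideanSpace.proj (𝕜 := ℝ) i).contDiff.comp hφ).of_le (by simp)
  have hci : ∀ i, HasCompactSupport fun x => φ x i := fun i =>
    hc.comp_left (g := fun v : E n => v i) rfl
  have heq : ∀ x, frob (r • (1 : Mat n n)) (grad φ x) =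
      ∑ i, r * fderiv ℝ (fun x => φ x i) x (EuclideanSpace.single i 1) := by
    intro x
    simp only [frob, Matrix.smul_apply, Matrix.one_apply, smul_eq_mul, mul_ite, mul_one, mul_zero,
      ite_mul, zero_mul, Finset.sum_ite_eq, Finset.mem_univ, if_true]
    refine Finset.sum_congr rfl fun i _ => ?_
    have hd : HasFDerivAt (fun x => φ x i)
        ((EuclideanSpace.proj (𝕜 := ℝ) i).comp (fderiv ℝ φ x)) x :=
      (EuclideanSpace.proj (𝕜 := ℝ) i).hasFDerivAt.comp x
        ((hφ.differentiable (by simp)) x).hasFDerivAt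
    rw [hd.fderiv]
    rfl
  have hint : ∀ i, Integrable fun x =>
      r * fderiv ℝ (fun x => φ x i) x (EuclideanSpace.single i 1) := fun i => by
    refine Integrable.const_mul ?_ r
    refine Continuous.integrable_of_hasCompactSupport
      (((hφi i).continuous_fderiv one_ne_zero).clm_apply continuous_const) ?_
    exact (hci i).fderiv_apply (𝕜 := ℝ) _
  have hi : Integrable fun x => frob (r • (1 : Mat n n)) (grad φ x) := by
    simp_rw [heq]
    exact integrable_finsetSum _ fun i _ => hint i
  refine ⟨hi.integrableOn, ?_⟩
  rw [setIntegral_eq_integral_of_forall_compl_eq_zero]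
  · simp_rw [heq]
    rw [integral_finsetSum _ fun i _ => hint i]
    refine Finset.sum_eq_zero fun i _ => ?_
    rw [integral_const_mul, integral_fderiv_eq_zero_of_hasCompactSupport (hφi i) (hci i), mul_zero]
  · intro x hx
    have h1 : fderiv ℝ φ x = 0 :=
      Function.notMem_support.1 fun h => hx (hs (support_fderiv_subset ℝ h))
    simp [grad, h1, frob]

theorem fderiv_density_sub_const (W : Mat m n → ℝ) (r : ℝ) (F : Mat m n) :
    fderiv ℝ (fun F => W F - r) F = fderiv ℝ W F :=
  fderiv_sub_const r

theorem piola_sub_const (W : Mat m n → ℝ) (r : ℝ) : piola (fun F => W F - r) = piola W := by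
  ext F i α
  simp [piola, fderiv_density_sub_const]

theorem eshelby_sub_const (W : Mat m n → ℝ) (r : ℝ) (F : Mat m n) :
    eshelby (fun F => W F - r) F = eshelby W F - r • (1 : Mat n n) := by
  simp only [eshelby, piola_sub_const, sub_smul]
  abel

theorem frob_sub_left (A B C : Mat m n) : frob (A - B) C = frob A C - frob B C := by
  simp [frob, sub_mul, Finset.sum_sub_distrib]

/-- Replacing `W` by `W - r` leaves `P` unchanged and subtracts the divergence-free tensor `r I`
from `P*`. -/
theorem divFree_eshelby_sub_const {W : Mat m n → ℝ} (hW : IsC1Density W) {Ω : Set (E n)}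
    (hΩ : IsOpen Ω) (hΩf : volume Ω ≠ ⊤) {y : E n → E m} {K : ℝ≥0} (hy : LipschitzWith K y)
    (hN : DivFree Ω fun x => eshelby W (grad y x)) (r : ℝ) :
    DivFree Ω fun x => eshelby (fun F => W F - r) (grad y x) := by
  intro φ hφ hc hs
  obtain ⟨K', hK'⟩ := (hφ.of_le (by simp) : ContDiff ℝ 1 φ).lipschitzWith_of_hasCompactSupport hc
    one_ne_zero
  obtain ⟨hi, hz⟩ := DivFree.lipschitz_test hΩ hΩf hy hW.continuous_eshelby hN hK' hc hs
  obtain ⟨hi1, hz1⟩ := divFree_one r φ hφ hc hs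
  simp_rw [eshelby_sub_const, frob_sub_left]
  rw [integral_sub hi hi1, hz, hz1, sub_zero]

end Shift

/-! ### Upper bound for the energy -/

section Upper

variable {m n : ℕ}

theorem chartHeight_pos_iff {ν : E n} {γ : E n → ℝ} {x : E n} :
    0 < chartHeight ν γ x ↔ inner ℝ ν x < γ (x - (inner ℝ ν x : ℝ) • ν) := sub_pos

/-- The Clapeyron flux points inwards in the boundary charts of a star-shaped domain. -/
theorem exists_inwardChart {W : Mat m n → ℝ} (hW : IsC1Density W) {r : ℝ} {Ω : Set (E n)}
    (hΩo : IsOpen Ω) {x₀ : E n} (hΩs : StarConvex ℝ x₀ Ω) (hΩL : HasLipschitzBoundary Ω)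
    {F₀ : Mat m n} {y : E n → E m} (hyc : Continuous y)
    (hbc : ∀ x ∈ frontier Ω, y x = affineMap F₀ x) (hreg : IsC2NearBoundary Ω y)
    (hrcx : ∀ᵐ x ∂(surfaceMeasure Ω),
      (W (gradWithin (closure Ω) y x) : EReal) = RW W (gradWithin (closure Ω) y x))
    (hr : RW W F₀ ≤ r) {p : E n} (hp : p ∈ frontier Ω) :
    ∃ U ν γ K G', p ∈ U ∧ InwardChart Ω (fun x => clapeyronFlux (fun F => W F - r) (x - x₀)
      (y x - affineMap F₀ x₀) (fderiv ℝ y x)) U ν γ K G' := by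
  obtain ⟨ν, hν, K, γ, hγ, U₁, hU₁, hchart⟩ := hΩL p hp
  obtain ⟨U₂, hU₂o, hU₂, hreg⟩ := hreg
  obtain ⟨K', hs⟩ := exists_lipschitzWith_chartHeight ν hγ
  set U := interior U₁ ∩ U₂
  have hUo : IsOpen U := isOpen_interior.inter hU₂o
  have hpU : p ∈ U := ⟨mem_interior_iff_mem_nhds.2 hU₁, hU₂ hp⟩
  have hΩU : ∀ x ∈ U, (x ∈ Ω ↔ 0 < chartHeight ν γ x) := fun x hx => by
    rw [chartHeight_pos_iff]; exact hchart x (interior_subset hx.1)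
  have huniq : UniqueDiffOn ℝ (closure Ω ∩ U) := by
    intro x hx
    refine UniqueDiffWithinAt.inter ?_ (hUo.mem_nhds hx.2)
    by_cases hxΩ : x ∈ Ω
    · exact (hΩo.uniqueDiffWithinAt hxΩ).mono subset_closure
    · refine (uniqueDiffWithinAt_of_chart hUo hν hs hΩU hx.2 ?_).mono subset_closure
      refine le_antisymm (not_lt.1 fun h => hxΩ ((hΩU x hx.2).2 h)) ?_
      exact chartHeight_nonneg_of_mem_closure hUo hs.continuous hΩU hx.2 hx.1
  have hyU : ContDiffOn ℝ 2 y (closure Ω ∩ U) :=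
    hreg.mono (inter_subset_inter_right _ inter_subset_right)
  have hfc : ContinuousOn (fderivWithin ℝ y (closure Ω)) (closure Ω ∩ U) := by
    refine (hyU.continuousOn_fderivWithin huniq (by simp)).congr fun x hx => ?_
    exact (fderivWithin_inter (hUo.mem_nhds hx.2)).symm
  have hW' : IsC1Density fun F => W F - r := hW.sub contDiff_const
  -- The boundary values of the flux use the derivative within `closure Ω`, which is continuous up
  -- to the boundary by `hreg`.
  refine ⟨U, ν, γ, K, fun x => clapeyronFlux (fun F => W F - r) (x - x₀)
      (y x - affineMap F₀ x₀) (fderivWithin ℝ y (closure Ω) x), hpU, hUo, hν, hγ, hΩU, ?_, ?_, ?_⟩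
  · refine hW'.continuous_clapeyronFlux.comp_continuousOn (f := fun x =>
      (x - x₀, y x - affineMap F₀ x₀, fderivWithin ℝ y (closure Ω) x)) ?_
    exact (continuousOn_id.sub continuousOn_const).prodMk
      ((hyc.continuousOn.sub continuousOn_const).prodMk hfc)
  · intro x hx
    have : fderivWithin ℝ y (closure Ω) x = fderiv ℝ y x :=
      fderivWithin_of_mem_nhds (mem_of_superset (hΩo.mem_nhds hx.1) subset_closure)
    simp only [this]
  · rw [surfaceMeasure, ae_restrict_iff' isClosed_frontier.measurableSet] at hrcx
    have hae := ae_graph_of_ae_hausdorffMeasure (γ := γ) hν (P := fun x => x ∈ frontier Ω →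
      (W (gradWithin (closure Ω) y x) : EReal) = RW W (gradWithin (closure Ω) y x))
      (by simpa using hrcx)
    filter_upwards [hae, ae_differentiableAt_chartHeight hν hγ] with z hz hdz hzU
    set q : E n := (z : E n) + γ z • ν with hq
    have hq0 : chartHeight ν γ q = 0 := by
      simpa using chartHeight_graph (γ := γ) hν z 0
    have hD : HasFDerivAt (chartHeight ν γ) (fderiv ℝ (chartHeight ν γ) (z : E n)) q :=
      hasFDerivAt_chartHeight_add_smul hν hdz.hasFDerivAt _
    have hqf : q ∈ frontier Ω := mem_frontier_of_chartHeight_eq_zero hUo hν hΩU hzU hq0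
    have hqc : q ∈ closure Ω := hqf.1
    have hyd : HasFDerivWithinAt y (fderivWithin ℝ y (closure Ω) q) (closure Ω) q := by
      have h1 : DifferentiableWithinAt ℝ y (closure Ω ∩ U) q :=
        (hyU.differentiableOn (by simp)) q ⟨hqc, hzU⟩
      exact ((differentiableWithinAt_inter (hUo.mem_nhds hzU)).1 h1).hasFDerivWithinAt
    have hu : y q - affineMap F₀ x₀ = affineMap F₀ (q - x₀) := by
      rw [hbc q hqf, ← affineCLM_apply, ← affineCLM_apply, ← affineCLM_apply, map_sub]
    rw [hu]
    refine functional_clapeyronFlux_nonneg ?_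
      (fderivWithin_tangential hUo hν hΩU hzU hq0 hD hs.continuous hyd hbc)
      (fderiv_chartHeight_sub_center_nonpos hUo hs.continuous hΩU hzU hqc hq0 hD hΩs)
    intro a b hab
    have := sub_fderiv_le_of_eq_RW hW hab (hz hqf) hr
    rw [fderiv_density_sub_const]
    linarith

/-- The Clapeyron flux of `W - r` points inwards, so the integral of its divergence `n (W - r)` is
non-positive. A real bound `r` replaces `RW W F₀`, whose finiteness is not yet known. -/
theorem integral_le_of_RW_le {W : Mat m n → ℝ} (hW : IsC1Density W) {r : ℝ} {Ω : Set (E n)}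
    (hΩo : IsOpen Ω) (hΩb : Bornology.IsBounded Ω) {x₀ : E n} (hΩs : StarConvex ℝ x₀ Ω)
    (hΩL : HasLipschitzBoundary Ω) {F₀ : Mat m n} {y : E n → E m} {K : ℝ≥0}
    (hy : LipschitzWith K y) (hEL : DivFree Ω fun x => piola W (grad y x))
    (hN : DivFree Ω fun x => eshelby W (grad y x))
    (hbc : ∀ x ∈ frontier Ω, y x = affineMap F₀ x) (hreg : IsC2NearBoundary Ω y)
    (hrcx : ∀ᵐ x ∂(surfaceMeasure Ω),
      (W (gradWithin (closure Ω) y x) : EReal) = RW W (gradWithin (closure Ω) y x))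
    (hr : RW W F₀ ≤ r) : ∫ x in Ω, (W (grad y x) - r) ≤ 0 := by
  -- For `n = 0` the factor `n` cannot be cancelled; there is then only one matrix, and `W` itself
  -- is rank-one convex.
  rcases Nat.eq_zero_or_pos n with rfl | hn
  · have hsub : ∀ F : Mat m 0, F = F₀ := fun F => by ext i j; exact j.elim0
    have hV : IsRankOneConvex W := fun F a b => by
      simp_rw [hsub]
      exact convexOn_const _ convex_univ
    have h1 : W F₀ ≤ r := EReal.coe_le_coe_iff.1 ((le_RW hV (fun _ => le_rfl) F₀).trans hr)
    simp_rw [hsub]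
    exact integral_nonpos fun x => sub_nonpos.2 h1
  · have hΩf : volume Ω ≠ ⊤ := hΩb.measure_lt_top.ne
    have hW' : IsC1Density fun F => W F - r := hW.sub contDiff_const
    obtain ⟨C, hC⟩ := exists_hasWeakDiv_clapeyronFlux hW' hΩo hΩb hy
      (by simpa only [piola_sub_const] using hEL)
      (divFree_eshelby_sub_const hW hΩo hΩf hy hN r) x₀ (affineMap F₀ x₀)
    have h := hC.integral_nonpos hΩo hΩb fun p hp =>
      exists_inwardChart hW hΩo hΩs hΩL hy.continuous hbc hreg hrcx hr hp
    rw [integral_const_mul] at h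
    have hn' : (0 : ℝ) < n := by exact_mod_cast hn
    exact nonpos_of_mul_nonpos_right h hn'

end Upper

/-! ### Lower bound by quasiconvexity and the case of equality -/

section Lower

variable {m n : ℕ}

/-- Extension by zero of a Lipschitz map vanishing on the boundary. -/
theorem lipschitzWith_indicator_of_frontier {E F : Type*} [NormedAddCommGroup E] [NormedSpace ℝ E]
    [NormedAddCommGroup F] {Ω : Set E} {w : E → F} {K : ℝ≥0} (hw : LipschitzWith K w)
    (h0 : ∀ x ∈ frontier Ω, w x = 0) : LipschitzWith K (indicator Ω w) := by
  have key : ∀ x x', x ∈ Ω → x' ∉ Ω → ‖w x‖ ≤ K * dist x x' := by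
    intro x x' hx hx'
    -- A segment from `Ω` to its complement is connected, so it meets the frontier.
    obtain ⟨p, hpseg, hp⟩ : ∃ p ∈ segment ℝ x x', p ∈ frontier Ω := by
      by_contra! hcon
      have hsub : segment ℝ x x' ⊆ interior Ω ∪ (closure Ω)ᶜ := fun p hp => by
        by_contra hnot
        rw [mem_union, not_or, mem_compl_iff, not_not] at hnot
        exact hcon p hp ⟨hnot.2, hnot.1⟩
      have hxi : x ∈ interior Ω := (hsub (left_mem_segment ℝ x x')).resolve_right
        fun h => h (subset_closure hx)
      have hxo : x' ∈ (closure Ω)ᶜ := (hsub (right_mem_segment ℝ x x')).resolve_left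
        fun h => hx' (interior_subset h)
      obtain ⟨p, -, hp1, hp2⟩ := (convex_segment x x').isPreconnected _ _ isOpen_interior
        isClosed_closure.isOpen_compl hsub ⟨x, left_mem_segment ℝ x x', hxi⟩
        ⟨x', right_mem_segment ℝ x x', hxo⟩
      exact hp2 (subset_closure (interior_subset hp1))
    have h1 := hw.dist_le_mul x p
    rw [h0 p hp, dist_zero_right] at h1
    refine h1.trans (mul_le_mul_of_nonneg_left ?_ K.coe_nonneg)
    rw [← dist_add_dist_of_mem_segment hpseg]
    exact le_add_of_nonneg_right dist_nonneg
  refine LipschitzWith.of_dist_le_mul fun x x' => ?_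
  by_cases hx : x ∈ Ω <;> by_cases hx' : x' ∈ Ω
  · rw [indicator_of_mem hx, indicator_of_mem hx']; exact hw.dist_le_mul x x'
  · rw [indicator_of_mem hx, indicator_of_notMem hx', dist_zero_right]; exact key x x' hx hx'
  · rw [indicator_of_notMem hx, indicator_of_mem hx', dist_zero_left, dist_comm]
    exact key x' x hx' hx
  · rw [indicator_of_notMem hx, indicator_of_notMem hx', dist_self]; positivity

/-- Functions that are Borel measurable and locally bounded have bounded composition with the
gradient of a Lipschitz map. -/
theorem integrableOn_comp_grad {V : Mat m n → ℝ} (hVm : Measurable[borel (Mat m n)] V)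
    (hVb : ∀ F, ∃ C : ℝ, ∀ᶠ G in 𝓝 F, |V G| ≤ C) {Ω : Set (E n)} (hΩf : volume Ω ≠ ⊤)
    {z : E n → E m} {K : ℝ≥0} (hz : LipschitzWith K z) :
    IntegrableOn (fun x => V (grad z x)) Ω := by
  have hmeas : Measurable fun x => V (grad z x) := by
    let _ : MeasurableSpace (Mat m n) := borel _
    have : BorelSpace (Mat m n) := ⟨rfl⟩
    have : TopologicalSpace.PseudoMetrizableSpace (Mat m n) :=
      inferInstanceAs (TopologicalSpace.PseudoMetrizableSpace (Fin m → Fin n → ℝ))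
    exact hVm.comp (measurable_comp_fderiv (continuous_toMat.comp continuous_snd) z)
  have hcomp : IsCompact (toMat '' Metric.closedBall (0 : E n →L[ℝ] E m) K) :=
    (isCompact_closedBall_clm _ _).image continuous_toMat
  obtain ⟨C, hC⟩ : ∃ C : ℝ, ∀ F ∈ toMat '' Metric.closedBall (0 : E n →L[ℝ] E m) K, |V F| ≤ C := by
    refine hcomp.induction_on (p := fun s => ∃ C : ℝ, ∀ F ∈ s, |V F| ≤ C) ⟨0, by simp⟩ ?_ ?_ ?_
    · rintro s t hst ⟨C, hC⟩
      exact ⟨C, fun F hF => hC F (hst hF)⟩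
    · rintro s t ⟨C, hC⟩ ⟨C', hC'⟩
      refine ⟨max C C', fun F hF => hF.elim (fun h => (hC F h).trans (le_max_left _ _))
        fun h => (hC' F h).trans (le_max_right _ _)⟩
    · intro F _
      obtain ⟨C, hC⟩ := hVb F
      exact ⟨_, mem_nhdsWithin_of_mem_nhds hC, C, fun G hG => hG⟩
  refine Integrable.mono' (g := fun _ => C) (integrableOn_const hΩf) hmeas.aestronglyMeasurable
    (Eventually.of_forall fun x => ?_)
  exact hC _ (mem_image_of_mem _ (LipschitzWith.fderiv_mem_closedBall hz x))

theorem integrableOn_density_comp_grad {W : Mat m n → ℝ} (hW : Continuous W) {Ω : Set (E n)}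
    (hΩf : volume Ω ≠ ⊤) {z : E n → E m} {K : ℝ≥0} (hz : LipschitzWith K z) :
    IntegrableOn (fun x => W (grad z x)) Ω := by
  refine integrableOn_comp_grad ?_ (fun F => ⟨|W F| + 1, ?_⟩) hΩf hz
  · let _ : MeasurableSpace (Mat m n) := borel _
    have : BorelSpace (Mat m n) := ⟨rfl⟩
    exact hW.measurable
  · filter_upwards [(hW.abs.tendsto F).eventually (Iio_mem_nhds (lt_add_one |W F|))] with G hG
      using le_of_lt hG

/-- `z - F₀ x` vanishes on the frontier, so its extension by zero is an admissible test map in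
Jensen's inequality. -/
theorem IsQuasiconvex.le_integral {V : Mat m n → ℝ} (hV : IsQuasiconvex V) {Ω : Set (E n)}
    (hΩo : IsOpen Ω) (hΩb : Bornology.IsBounded Ω) {F₀ : Mat m n} {z : E n → E m} {K : ℝ≥0}
    (hz : LipschitzWith K z) (hbc : ∀ x ∈ frontier Ω, z x = affineMap F₀ x) :
    volume.real Ω * V F₀ ≤ ∫ x in Ω, V (grad z x) := by
  have hw : LipschitzWith _ (fun x => z x - affineCLM F₀ x) := hz.sub (affineCLM F₀).lipschitz
  have hφ := lipschitzWith_indicator_of_frontier (Ω := Ω) hw fun x hx => by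
    rw [hbc x hx, affineCLM_apply, sub_self]
  refine (hV.jensen Ω hΩo hΩb _ ⟨_, hφ⟩ (fun x hx => indicator_of_notMem hx _) F₀).trans_eq ?_
  refine integral_congr_ae ?_
  filter_upwards [ae_restrict_mem hΩo.measurableSet,
    ae_restrict_of_ae (hz.ae_differentiableAt (μ := volume))] with x hx hd
  have h1 : indicator Ω (fun x => z x - affineCLM F₀ x) =ᶠ[𝓝 x] fun x => z x - affineCLM F₀ x := by
    filter_upwards [hΩo.mem_nhds hx] with w hw using indicator_of_mem hw _
  have h2 : HasFDerivAt (fun x => z x - affineCLM F₀ x) (fderiv ℝ z x - affineCLM F₀) x :=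
    hd.hasFDerivAt.sub (affineCLM F₀).hasFDerivAt
  have h3 : F₀ + grad (indicator Ω fun x => z x - affineCLM F₀ x) x = grad z x := by
    rw [grad_eq, grad_eq, h1.fderiv_eq, h2.fderiv]
    conv_lhs => enter [1]; rw [← toMat_affineCLM F₀]
    rw [← toMat_add, add_sub_cancel]
  exact congrArg V h3

theorem grad_eq_of_eqOn {Ω : Set (E n)} (hΩo : IsOpen Ω) {y z : E n → E m}
    (h : EqOn y z (closure Ω)) {x : E n} (hx : x ∈ Ω) : grad y x = grad z x := by
  have : y =ᶠ[𝓝 x] z := by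
    filter_upwards [hΩo.mem_nhds hx] with w hw using h (subset_closure hw)
  rw [grad_eq, grad_eq, this.fderiv_eq]

theorem mul_le_energy {W : Mat m n → ℝ} (hW : Continuous W) {Ω : Set (E n)} (hΩo : IsOpen Ω)
    (hΩb : Bornology.IsBounded Ω) {F₀ : Mat m n} {r : ℝ} (hr : (r : EReal) ≤ QW W F₀)
    {z : E n → E m} (hz : z ∈ admissible Ω F₀) : volume.real Ω * r ≤ energy W Ω z := by
  obtain ⟨⟨K, hzK⟩, hbc⟩ := hz
  obtain ⟨z', hz', heq⟩ := hzK.extend_finite_dimension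
  have hΩf : volume Ω ≠ ⊤ := hΩb.measure_lt_top.ne
  have hE : energy W Ω z = ∫ x in Ω, W (grad z' x) :=
    setIntegral_congr_fun hΩo.measurableSet fun x hx => by rw [grad_eq_of_eqOn hΩo heq hx]
  have hbc' : ∀ x ∈ frontier Ω, z' x = affineMap F₀ x := fun x hx => by
    rw [← heq hx.1, hbc x hx]
  have key : ∀ c < r, volume.real Ω * c ≤ energy W Ω z := by
    intro c hc
    obtain ⟨V, hV, hVW, hlt⟩ := exists_lt_of_lt_QW ((EReal.coe_lt_coe_iff.2 hc).trans_le hr)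
    rw [hE]
    refine (mul_le_mul_of_nonneg_left hlt.le measureReal_nonneg).trans
      ((hV.le_integral hΩo hΩb hz' hbc').trans ?_)
    exact integral_mono (integrableOn_comp_grad hV.measurable hV.locallyBounded hΩf hz')
      (integrableOn_density_comp_grad hW hΩf hz') fun x => hVW _
  have hlim : Tendsto (fun c : ℝ => volume.real Ω * c) (𝓝[<] r) (𝓝 (volume.real Ω * r)) :=
    ((continuous_const.mul continuous_id).tendsto r).mono_left nhdsWithin_le_nhds
  exact le_of_tendsto hlim (by filter_upwards [self_mem_nhdsWithin] with c hc using key c hc)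

/-- If the energy attains the quasiconvex lower bound, then `W` agrees with its quasiconvex envelope
at almost all gradients. -/
theorem ae_QW_eq {W : Mat m n → ℝ} (hW : Continuous W) {Ω : Set (E n)} (hΩo : IsOpen Ω)
    (hΩb : Bornology.IsBounded Ω) {F₀ : Mat m n} {r : ℝ} (hr : (r : EReal) ≤ QW W F₀)
    {z : E n → E m} {K : ℝ≥0} (hz : LipschitzWith K z)
    (hbc : ∀ x ∈ frontier Ω, z x = affineMap F₀ x)
    (hE : ∫ x in Ω, W (grad z x) ≤ volume.real Ω * r) :
    ∀ᵐ x ∂(volume.restrict Ω), QW W (grad z x) = (W (grad z x) : EReal) := by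
  have hΩf : volume Ω ≠ ⊤ := hΩb.measure_lt_top.ne
  have hex : ∀ k : ℕ, ∃ V : Mat m n → ℝ, IsQuasiconvex V ∧ (∀ G, V G ≤ W G) ∧
      r - 1 / ((k : ℝ) + 1) < V F₀ := fun k =>
    exists_lt_of_lt_QW ((EReal.coe_lt_coe_iff.2 (sub_lt_self r (by positivity))).trans_le hr)
  choose V hV hVW hlt using hex
  have hWi := integrableOn_density_comp_grad hW hΩf hz
  have hVi : ∀ k, IntegrableOn (fun x => V k (grad z x)) Ω := fun k =>
    integrableOn_comp_grad (hV k).measurable (hV k).locallyBounded hΩf hz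
  let g : ℕ → E n → ℝ := fun k x => W (grad z x) - V k (grad z x)
  have hg0 : ∀ k x, 0 ≤ g k x := fun k x => sub_nonneg.2 (hVW k _)
  have hgi : ∀ k, IntegrableOn (g k) Ω := fun k => hWi.sub (hVi k)
  have hgint : ∀ k, ∫ x in Ω, g k x ≤ volume.real Ω * (1 / ((k : ℝ) + 1)) := by
    intro k
    have h1 := (hV k).le_integral hΩo hΩb hz hbc
    have h2 := mul_le_mul_of_nonneg_left (hlt k).le (measureReal_nonneg (μ := volume) (s := Ω))
    have h3 : ∫ x in Ω, g k x = (∫ x in Ω, W (grad z x)) - ∫ x in Ω, V k (grad z x) :=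
      integral_sub hWi (hVi k)
    rw [h3]
    linarith
  -- The gaps `W - V k` have integral at most `|Ω|/(k+1)`, so their infimum vanishes almost
  -- everywhere. Where it vanishes, the `V k` come arbitrarily close to `W`, and `QW` lies between.
  have hlint : ∫⁻ x in Ω, ⨅ k, ENNReal.ofReal (g k x) = 0 := by
    have hle : ∀ k : ℕ, ∫⁻ x in Ω, ⨅ k, ENNReal.ofReal (g k x) ≤
        ENNReal.ofReal (volume.real Ω * (1 / ((k : ℝ) + 1))) := fun k => by
      refine (lintegral_mono fun x => iInf_le _ k).trans ?_
      rw [← ofReal_integral_eq_lintegral_ofReal (hgi k) (Eventually.of_forall (hg0 k))]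
      exact ENNReal.ofReal_le_ofReal (hgint k)
    have hlim : Tendsto (fun k : ℕ => ENNReal.ofReal (volume.real Ω * (1 / ((k : ℝ) + 1)))) atTop
        (𝓝 0) := by
      have := (tendsto_one_div_add_atTop_nhds_zero_nat (𝕜 := ℝ)).const_mul (volume.real Ω)
      rw [mul_zero] at this
      have h2 := (ENNReal.continuous_ofReal.tendsto 0).comp this
      rw [ENNReal.ofReal_zero] at h2
      exact h2
    exact nonpos_iff_eq_zero.1 (ge_of_tendsto' hlim hle)
  have hm : AEMeasurable (fun x => ⨅ k, ENNReal.ofReal (g k x)) (volume.restrict Ω) :=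
    AEMeasurable.iInf fun k => (hgi k).aestronglyMeasurable.aemeasurable.ennreal_ofReal
  filter_upwards [(lintegral_eq_zero_iff' hm).1 hlint] with x hx
  refine le_antisymm (QW_le W _) (not_lt.1 fun hlt' => ?_)
  obtain ⟨c, hc1, hc2⟩ := EReal.lt_iff_exists_real_btwn.1 hlt'
  have hc2' : c < W (grad z x) := EReal.coe_lt_coe_iff.1 hc2
  have hpos : (⨅ k, ENNReal.ofReal (g k x)) < ENNReal.ofReal (W (grad z x) - c) := by
    rw [hx]
    exact ENNReal.ofReal_pos.2 (sub_pos.2 hc2')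
  obtain ⟨k, hk⟩ := iInf_lt_iff.1 hpos
  have h1 : g k x < W (grad z x) - c := (ENNReal.ofReal_lt_ofReal_iff (sub_pos.2 hc2')).1 hk
  have h2 : c < V k (grad z x) := by simp only [g] at h1; linarith
  exact absurd ((EReal.coe_lt_coe_iff.2 h2).trans_le (le_QW (hV k) (hVW k) _)) (not_lt.2 hc1.le)

end Lower

end GCT

/-! ### The two bounds combined -/

theorem mainTheorem5 {m n : ℕ} (W : GCT.Mat m n → ℝ) (hW : GCT.IsC1Density W)
    (Ω : Set (GCT.E n)) (hΩo : IsOpen Ω) (hΩb : Bornology.IsBounded Ω)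
    (hΩs : ∃ x₀ ∈ Ω, StarConvex ℝ x₀ Ω) (hΩL : GCT.HasLipschitzBoundary Ω)
    (F₀ : GCT.Mat m n) (y : GCT.E n → GCT.E m)
    (hstat : GCT.IsStationary W Ω y)
    (hbc : ∀ x ∈ frontier Ω, y x = GCT.affineMap F₀ x)
    (hreg : GCT.IsC2NearBoundary Ω y)
    (hrcx : ∀ᵐ x ∂(GCT.surfaceMeasure Ω),
      (W (GCT.gradWithin (closure Ω) y x) : EReal) = GCT.RW W (GCT.gradWithin (closure Ω) y x))
    (hQR : GCT.RW W F₀ = GCT.QW W F₀) :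
    (GCT.RW W F₀ = ((⨍ x in Ω, W (GCT.grad y x) : ℝ) : EReal) ∧
      GCT.QW W F₀ = ((⨍ x in Ω, W (GCT.grad y x) : ℝ) : EReal) ∧
      y ∈ GCT.admissible Ω F₀ ∧ IsMinOn (GCT.energy W Ω) (GCT.admissible Ω F₀) y) ∧
    ∀ᵐ x ∂(volume.restrict Ω), GCT.QW W (GCT.grad y x) = (W (GCT.grad y x) : EReal) := by
  obtain ⟨x₀, hx₀, hstar⟩ := hΩs
  have hyadm : y ∈ GCT.admissible Ω F₀ := ⟨hstat.lipschitz, hbc⟩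
  obtain ⟨K, hyK⟩ := hstat.lipschitz
  -- `y` is controlled only on `closure Ω`; a global Lipschitz extension has the same gradients in
  -- `Ω` and the same one-sided gradients on the boundary.
  obtain ⟨z, hz, heq⟩ := hyK.extend_finite_dimension
  have hΩf : volume Ω ≠ ⊤ := hΩb.measure_lt_top.ne
  have hvol : 0 < volume.real Ω :=
    ENNReal.toReal_pos (hΩo.measure_pos volume ⟨x₀, hx₀⟩).ne' hΩf
  have hWc : Continuous W := GCT.IsC1Density.continuous hW
  have hgrad : ∀ x ∈ Ω, GCT.grad y x = GCT.grad z x := fun x hx =>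
    GCT.grad_eq_of_eqOn hΩo heq hx
  have hE : GCT.energy W Ω y = ∫ x in Ω, W (GCT.grad z x) :=
    setIntegral_congr_fun hΩo.measurableSet fun x hx => by rw [hgrad x hx]
  have hzbc : ∀ x ∈ frontier Ω, z x = GCT.affineMap F₀ x := fun x hx => by
    rw [← heq hx.1, hbc x hx]
  have hzEL : GCT.DivFree Ω fun x => GCT.piola W (GCT.grad z x) := fun φ h1 h2 h3 => by
    rw [← hstat.eulerLagrange φ h1 h2 h3]
    exact setIntegral_congr_fun hΩo.measurableSet fun x hx => by simp only [hgrad x hx]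
  have hzN : GCT.DivFree Ω fun x => GCT.eshelby W (GCT.grad z x) := fun φ h1 h2 h3 => by
    rw [← hstat.noether φ h1 h2 h3]
    exact setIntegral_congr_fun hΩo.measurableSet fun x hx => by simp only [hgrad x hx]
  have hzreg : GCT.IsC2NearBoundary Ω z := by
    obtain ⟨U, hU, hfU, hc⟩ := hreg
    exact ⟨U, hU, hfU, hc.congr fun x hx => (heq hx.1).symm⟩
  have hzrcx : ∀ᵐ x ∂(GCT.surfaceMeasure Ω),
      (W (GCT.gradWithin (closure Ω) z x) : EReal) =
        GCT.RW W (GCT.gradWithin (closure Ω) z x) := by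
    have hmem : ∀ᵐ x ∂(GCT.surfaceMeasure Ω), x ∈ frontier Ω :=
      ae_restrict_mem isClosed_frontier.measurableSet
    filter_upwards [hrcx, hmem] with x hx hxf
    have : GCT.gradWithin (closure Ω) z x = GCT.gradWithin (closure Ω) y x := by
      rw [GCT.gradWithin_eq, GCT.gradWithin_eq,
        fderivWithin_congr (fun w hw => (heq hw).symm) (heq hxf.1).symm]
    rw [this]
    exact hx
  have hzi := GCT.integrableOn_density_comp_grad hWc hΩf hz
  have hupper : ∀ r : ℝ, GCT.RW W F₀ ≤ r → GCT.energy W Ω y ≤ volume.real Ω * r := by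
    intro r hr
    have h := GCT.integral_le_of_RW_le hW hΩo hΩb hstar hΩL hz hzEL hzN hzbc hzreg hzrcx hr
    rw [integral_sub hzi (integrableOn_const hΩf), setIntegral_const, smul_eq_mul] at h
    rw [hE]
    linarith
  -- `RW W F₀` is finite. If it were `-∞`, every real `r` would be allowed, and this choice would
  -- bound the energy by itself minus one; `+∞` is excluded by `RW = QW ≤ W` at `F₀`.
  obtain ⟨ρ, hρ⟩ : ∃ ρ : ℝ, GCT.RW W F₀ = ρ := by
    induction h : GCT.RW W F₀ with
    | bot =>
      have h1 := hupper ((GCT.energy W Ω y - 1) / volume.real Ω) (by rw [h]; exact bot_le)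
      rw [mul_div_cancel₀ _ hvol.ne'] at h1
      linarith
    | coe ρ => exact ⟨ρ, rfl⟩
    | top =>
      have h1 := GCT.QW_le W F₀
      rw [← hQR, h] at h1
      exact absurd h1 (not_le.2 (EReal.coe_lt_top _))
  have hρQ : (ρ : EReal) ≤ GCT.QW W F₀ := by rw [← hQR, hρ]
  have hle : GCT.energy W Ω y ≤ volume.real Ω * ρ := hupper ρ hρ.le
  have hge : ∀ w ∈ GCT.admissible Ω F₀, volume.real Ω * ρ ≤ GCT.energy W Ω w := fun w hw =>
    GCT.mul_le_energy hWc hΩo hΩb hρQ hw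
  have havg : (⨍ x in Ω, W (GCT.grad y x)) = ρ := by
    have h1 : ∫ x in Ω, W (GCT.grad y x) = volume.real Ω * ρ := le_antisymm hle (hge y hyadm)
    rw [setAverage_eq, h1, smul_eq_mul, inv_mul_cancel_left₀ hvol.ne']
  refine ⟨⟨by rw [havg, hρ], by rw [havg, ← hQR, hρ], hyadm, fun w hw => hle.trans (hge w hw)⟩, ?_⟩
  filter_upwards [GCT.ae_QW_eq hWc hΩo hΩb hρQ hz hzbc (by rw [← hE]; exact hle),
    ae_restrict_mem hΩo.measurableSet] with x hx hxΩ
  rw [hgrad x hxΩ]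
  exact hx
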